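/- Let $\mathcal T=[a,b]$ with $-\infty<a<b<\infty$, and let $y_{ij}(t)=\eta_i(t)+v_{ij}(t)$, $t\in\mathcal T$, $j=1,\dots,n_i$, $i=1,\dots,k$, be $k$ independent functional samples, where $\eta_i\in L^2(\mathcal T)$ and $v_{i1},v_{i2},\dots$ are i.i.d. (jointly measurable) stochastic processes with mean function $0$ and covariance function $\gamma_i$, $\operatorname{tr}(\gamma_i)=\int_{\mathcal T}\gamma_i(t,t)\,dt<\infty$. Put $n=\sum_i n_i$ and $$\hat\gamma_i(s,t)=\frac1{n_i-1}\sum_{j=1}^{n_i}[y_{ij}(s)-\bar y_i(s)][y_{ij}(t)-\bar y_i(t)],\qquad \hat\gamma(s,t)=\frac{\sum_{i=1}^k(n_i-1)\hat\gamma_i(s,t)}{n-k}.$$ Assume: (A1) the samples are Gaussian; (A2) as $n\to\infty$, $n_i/n\to\tau_i\in(0,1)$ for each $i$; (A3) the functions $\gamma_i$ are uniformly bounded on $\mathcal T^2$; and ($H_0$) $\gamma_1=\dots=\gamma_k=:\gamma$ on $\mathcal T^2$, with $\operatorname{tr}(\gamma)>0$. For $g:\mathcal T^2\to\mathbb R$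 write $\operatorname{tr}(g)=\int g(t,t)\,dt$, $\operatorname{tr}(g^{\otimes2})=\iint g^2(s,t)\,ds\,dt$, $\operatorname{tr}(g^{\otimes4})=\int\!\!\int\!\!\int\!\!\int g(t,u_1)g(u_1,u_2)g(u_2,u_3)g(u_3,t)\,du_1du_2du_3dt$, and for $w:\mathcal T^2\times\mathcal T^2\to\mathbb R$ write $\operatorname{tr}(w)=\iint w[(s,t),(s,t)]\,ds\,dt$, $\operatorname{tr}(w^{\otimes2})=\int\!\!\int\!\!\int\!\!\int w^2[(s_1,t_1),(s_2,t_2)]\,ds_1dt_1ds_2dt_2$ (all integrals over $\mathcal T$). Then the covariance function $\varpi[(s_1,t_1),(s_2,t_2)]$ of the random field $\sqrt{n-k}\,[\hat\gamma(s,t)-\gamma(s,t)]$ does not depend on the sample sizes $n_i\ge2$, and $\operatorname{tr}(\varpi)>0$, $\operatorname{tr}(\varpi^{\otimes2})>0$. Let $$\beta=\frac{\operatorname{tr}(\varpi^{\otimes2})}{\operatorname{tr}(\varpi)},\qquad \kappa=\frac{\operatorname{tr}^2(\varpi)}{\operatorname{tr}(\varpi^{\otimes2})}.$$ The naive estimators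 are $\hat\beta=\operatorname{tr}(\hat\varpi^{\otimes2})/\operatorname{tr}(\hat\varpi)$ and $\hat\kappa=\operatorname{tr}^2(\hat\varpi)/\operatorname{tr}(\hat\varpi^{\otimes2})$ with $\hat\varpi[(s_1,t_1),(s_2,t_2)]=\hat\gamma(s_1,s_2)\hat\gamma(t_1,t_2)+\hat\gamma(s_1,t_2)\hat\gamma(s_2,t_1)$. The bias-reduced estimators are $\hat\beta=B/A$ and $\hat\kappa=A^2/B$ with $A=D+E$, $B=2E^2+2\operatorname{tr}(\hat\gamma^{\otimes4})$, $$D=\frac{(n-k)(n-k+1)}{(n-k-1)(n-k+2)}\Big[\operatorname{tr}^2(\hat\gamma)-\frac{2\operatorname{tr}(\hat\gamma^{\otimes2})}{n-k+1}\Big],\qquad E=\frac{(n-k)^2}{(n-k-1)(n-k+2)}\Big[\operatorname{tr}(\hat\gamma^{\otimes2})-\frac{\operatorname{tr}^2(\hat\gamma)}{n-k}\Big].$$ For both methods, as $n\to\infty$, $\hat\beta\to\beta$ and $\hat\kappa\to\kappa$ in probability. Moreover, for every $\alpha\in(0,1)$, with $\chi^2_d(\alpha)$ the upper $100\alpha$-percentile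 of the chi-square distribution with $d>0$ (real) degrees of freedom, $$\hat\beta\,\chi^2_{(k-1)\hat\kappa}(\alpha)\ \longrightarrow\ \beta\,\chi^2_{(k-1)\kappa}(\alpha)\quad\text{in probability.}$$ -/

import Mathlib

open MeasureTheory ProbabilityTheory Filter Topology

noncomputable section

namespace ECF

/-- The time interval `𝒯 = [a, b]`, with its Borel sets and Lebesgue measure. -/
abbrev Time (a b : ℝ) : Type := ↥(Set.Icc a b)

instance instMeasureSpaceTime (a b : ℝ) : MeasureSpace (Time a b) :=
  Measure.Subtype.measureSpace

/-! ### Traces -/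

section Traces

variable {a b : ℝ}

/-- `tr(γ) = ∫ γ(t,t) dt`. -/
def tr (g : Time a b → Time a b → ℝ) : ℝ := ∫ t, g t t

/-- `tr(γ^{⊗2}) = ∫∫ γ(s,t)² ds dt`. -/
def trTwo (g : Time a b → Time a b → ℝ) : ℝ := ∫ s, ∫ t, g s t ^ 2

/-- `tr(γ^{⊗4}) = ∫∫∫∫ γ(t,u₁) γ(u₁,u₂) γ(u₂,u₃) γ(u₃,t)`. -/
def trFour (g : Time a b → Time a b → ℝ) : ℝ :=
  ∫ t, ∫ u₃, ∫ u₂, ∫ u₁, g t u₁ * g u₁ u₂ * g u₂ u₃ * g u₃ t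

/-- `tr(ϖ) = ∫∫ ϖ[(s,t),(s,t)] ds dt` for a kernel on `𝒯²`. -/
def trK (w : Time a b × Time a b → Time a b × Time a b → ℝ) : ℝ :=
  ∫ s, ∫ t, w (s, t) (s, t)

/-- `tr(ϖ^{⊗2}) = ∫∫∫∫ ϖ²[(s₁,t₁),(s₂,t₂)] ds₁ dt₁ ds₂ dt₂`. -/
def trTwoK (w : Time a b × Time a b → Time a b × Time a b → ℝ) : ℝ :=
  ∫ s₁, ∫ t₁, ∫ s₂, ∫ t₂, w (s₁, t₁) (s₂, t₂) ^ 2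

/-- `β = tr(ϖ^{⊗2}) / tr(ϖ)`. -/
def beta (w : Time a b × Time a b → Time a b × Time a b → ℝ) : ℝ := trTwoK w / trK w

/-- `κ = tr²(ϖ) / tr(ϖ^{⊗2})`. -/
def kappa (w : Time a b × Time a b → Time a b × Time a b → ℝ) : ℝ := trK w ^ 2 / trTwoK w

end Traces

/-! ### Estimators, as functions of the observed curves

`x i j` is the `j`-th curve of the `i`-th group (`j = 0, 1, …`), and `N i` is the size of
the `i`-th sample. -/

section Estimators

variable {a b : ℝ} {k : ℕ}

/-- Sample mean function of the curves `x 0, …, x (n-1)`. -/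
def sampleMean (n : ℕ) (x : ℕ → Time a b → ℝ) (t : Time a b) : ℝ :=
  (n : ℝ)⁻¹ * ∑ j ∈ Finset.range n, x j t

/-- Sample covariance function of the curves `x 0, …, x (n-1)`. -/
def sampleCov (n : ℕ) (x : ℕ → Time a b → ℝ) (s t : Time a b) : ℝ :=
  ((n : ℝ) - 1)⁻¹ *
    ∑ j ∈ Finset.range n, (x j s - sampleMean n x s) * (x j t - sampleMean n x t)

/-- Total sample size. -/
def total (N : Fin k → ℕ) : ℕ := ∑ i, N i

/-- Error degrees of freedom `n - k`, as a real number. -/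
def dof (N : Fin k → ℕ) : ℝ := (total N : ℝ) - (k : ℝ)

/-- Pooled sample covariance function. -/
def pooledCov (N : Fin k → ℕ) (x : Fin k → ℕ → Time a b → ℝ) (s t : Time a b) : ℝ :=
  (∑ i, ((N i : ℝ) - 1) * sampleCov (N i) (x i) s t) / dof N

/-- Plug-in kernel
`ϖ̂[(s₁,t₁),(s₂,t₂)] = γ̂(s₁,s₂) γ̂(t₁,t₂) + γ̂(s₁,t₂) γ̂(s₂,t₁)`. -/
def plugIn (g : Time a b → Time a b → ℝ) (p q : Time a b × Time a b) : ℝ :=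
  g p.1 q.1 * g p.2 q.2 + g p.1 q.2 * g q.1 p.2

/-- Naive estimator of `β`. -/
def betaNaive (N : Fin k → ℕ) (x : Fin k → ℕ → Time a b → ℝ) : ℝ :=
  beta (plugIn (pooledCov N x))

/-- Naive estimator of `κ`. -/
def kappaNaive (N : Fin k → ℕ) (x : Fin k → ℕ → Time a b → ℝ) : ℝ :=
  kappa (plugIn (pooledCov N x))

/-- Bias-reduced estimator of `tr²(γ)`. -/
def trSqBR (N : Fin k → ℕ) (x : Fin k → ℕ → Time a b → ℝ) : ℝ :=
  dof N * (dof N + 1) / ((dof N - 1) * (dof N + 2)) *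
    (tr (pooledCov N x) ^ 2 - 2 * trTwo (pooledCov N x) / (dof N + 1))

/-- Bias-reduced estimator of `tr(γ^{⊗2})`. -/
def trTwoBR (N : Fin k → ℕ) (x : Fin k → ℕ → Time a b → ℝ) : ℝ :=
  dof N ^ 2 / ((dof N - 1) * (dof N + 2)) *
    (trTwo (pooledCov N x) - tr (pooledCov N x) ^ 2 / dof N)

/-- Bias-reduced estimator of `tr(ϖ)`. -/
def trKBR (N : Fin k → ℕ) (x : Fin k → ℕ → Time a b → ℝ) : ℝ :=
  trSqBR N x + trTwoBR N x

/-- Bias-reduced estimator of `tr(ϖ^{⊗2})`. -/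
def trTwoKBR (N : Fin k → ℕ) (x : Fin k → ℕ → Time a b → ℝ) : ℝ :=
  2 * trTwoBR N x ^ 2 + 2 * trFour (pooledCov N x)

/-- Bias-reduced estimator of `β`. -/
def betaBR (N : Fin k → ℕ) (x : Fin k → ℕ → Time a b → ℝ) : ℝ :=
  trTwoKBR N x / trKBR N x

/-- Bias-reduced estimator of `κ`. -/
def kappaBR (N : Fin k → ℕ) (x : Fin k → ℕ → Time a b → ℝ) : ℝ :=
  trKBR N x ^ 2 / trTwoKBR N x

end Estimators

/-! ### Chi-square critical values -/

/-- The chi-square distribution with `d > 0` (real) degrees of freedom. -/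
def chiSq (d : ℝ) : Measure ℝ := gammaMeasure (d / 2) (1 / 2)

/-- The upper `100α`-percentile `χ²_d(α)`: for `d > 0` and `0 < α < 1` it is the unique `q`
with `P(χ²_d > q) = α`. -/
def chiSqUpper (d α : ℝ) : ℝ := sInf {q : ℝ | (chiSq d).real (Set.Ioi q) ≤ α}

/-- `β χ²_{(k-1)κ}(α)`. -/
def critValue (k : ℕ) (α β κ : ℝ) : ℝ := β * chiSqUpper (((k : ℝ) - 1) * κ) α

/-! ### The model -/

section Model

variable {a b : ℝ} {k : ℕ} {Ω : Type*} [MeasurableSpace Ω]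

/-- The `k` independent functional samples `y_{ij} = η_i + v_{ij}`, with
`v_{i0}, v_{i1}, …` i.i.d. `SP(0, γ_i)`, `η_i ∈ L²(𝒯)` and `tr(γ_i) < ∞`. -/
structure IsFunctionalSamples (P : Measure Ω) (η : Fin k → Time a b → ℝ)
    (γ : Fin k → Time a b → Time a b → ℝ) (v y : Fin k → ℕ → Time a b → Ω → ℝ) : Prop where
  model : ∀ i j t ω, y i j t ω = η i t + v i j t ω
  mean_memLp : ∀ i, MemLp (η i) 2 volume
  measurable : ∀ i j, Measurable (fun p : Time a b × Ω => v i j p.1 p.2)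
  memLp : ∀ i j t, MemLp (v i j t) 2 P
  centered : ∀ i j t, P[v i j t] = 0
  covariance_eq : ∀ i j s t, cov[v i j s, v i j t; P] = γ i s t
  indep : iIndepFun (fun (p : Fin k × ℕ) (ω : Ω) (t : Time a b) => v p.1 p.2 t ω) P
  identDistrib : ∀ i j j', IdentDistrib (fun (ω : Ω) (t : Time a b) => v i j t ω)
    (fun (ω : Ω) (t : Time a b) => v i j' t ω) P P
  trace_finite : ∀ i, Integrable (fun t => γ i t t) volume

/-- The observed curves at the outcome `ω`. -/
def curves (y : Fin k → ℕ → Time a b → Ω → ℝ) (ω : Ω) : Fin k → ℕ → Time a b → ℝ :=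
  fun i j t => y i j t ω

/-- The covariance function of the random field `√(n-k) [γ̂(s,t) - γ(s,t)]`. -/
def pooledCovKernel (P : Measure Ω) (N : Fin k → ℕ) (g : Time a b → Time a b → ℝ)
    (y : Fin k → ℕ → Time a b → Ω → ℝ) (p q : Time a b × Time a b) : ℝ :=
  cov[fun ω => √(dof N) * (pooledCov N (curves y ω) p.1 p.2 - g p.1 p.2),
    fun ω => √(dof N) * (pooledCov N (curves y ω) q.1 q.2 - g q.1 q.2); P]

end Model

end ECF

end

/-! The residuals `v_ij - v̄_i` form a centered Gaussian process whose covariance is `γ₀` times the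
block-diagonal matrix of group centering projections. That matrix is a projection of rank `n - k`,
so its trace and its squared Frobenius norm both equal `n - k`. With Isserlis' formula this makes
the pooled covariance unbiased with covariance kernel `plugIn γ₀ / (n - k)` (`integral_pooledCov`,
`covariance_pooledCov`). Hence `ϖ = plugIn γ₀` for all sample sizes, and the mean squared error,
integrated over the square or along its diagonal, is of order `1 / (n - k)`.

Expanding the kernel gives `tr(ϖ) = tr²(γ) + tr(γ^{⊗2})` and `tr(ϖ^{⊗2}) = 2 tr²(γ^{⊗2}) + 2
tr(γ^{⊗4})`, and likewise for the plug-in kernel, so everything reduces to three traces. The last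
two are continuous in `L²` of the square by Cauchy–Schwarz (`tendsto_trTwo`, `tendsto_trFour`); the
first is controlled by the error on the diagonal. The bias-reducing coefficients tend to `1` and the
corrections to `0`, so both methods share their limits.

The quotients are harmless once `tr(ϖ)` and `tr(ϖ^{⊗2})` are positive, which rests on `trTwo_pos`:
positive trace forces `γ₀` to be nonzero in `L²`, although the diagonal is a null set. The critical
value then converges because the chi-square percentile is continuous in the degrees of freedom
(`chiSqUpper_continuousAt`).

Convergence in probability to a constant is written as a limit along the filter `inProbability`, so
Slutsky and continuous mapping become composition of limits. -/

/-! ### Convergence in probability to a constant, as convergence along a filter -/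

namespace MeasureTheory

variable {ι Ω E : Type*} [MeasurableSpace Ω]

/-- The filter on `ι × Ω` of the sets whose sections have complements of measure tending to `0`
along `l`. -/
def inProbability (P : Measure Ω) (l : Filter ι) : Filter (ι × Ω) where
  sets := {S | Tendsto (fun m => P {ω | (m, ω) ∉ S}) l (𝓝 0)}
  univ_sets := by simpa using tendsto_const_nhds
  sets_of_superset := by
    intro S T hS hST
    exact tendsto_of_tendsto_of_tendsto_of_le_of_le tendsto_const_nhds hS (fun _ => zero_le)
      (fun m => measure_mono fun ω hω h => hω (hST h))
  inter_sets := by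
    intro S T hS hT
    have h := Tendsto.add hS hT
    rw [add_zero] at h
    refine tendsto_of_tendsto_of_tendsto_of_le_of_le tendsto_const_nhds h (fun _ => zero_le)
      (fun m => le_trans (measure_mono ?_) (measure_union_le _ _))
    intro ω hω
    simp only [Set.mem_inter_iff, Set.mem_ofPred_eq, not_and_or] at hω
    exact hω

theorem eventually_inProbability_iff {P : Measure Ω} {l : Filter ι} {p : ι × Ω → Prop} :
    (∀ᶠ x in inProbability P l, p x) ↔ Tendsto (fun m => P {ω | ¬ p (m, ω)}) l (𝓝 0) :=
  Iff.rfl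

theorem tendstoInMeasure_const_iff_tendsto_inProbability [PseudoMetricSpace E]
    {P : Measure Ω} {l : Filter ι} {X : ι → Ω → E} {c : E} :
    TendstoInMeasure P X l (fun _ => c) ↔
      Tendsto (fun x : ι × Ω => X x.1 x.2) (inProbability P l) (𝓝 c) := by
  rw [tendstoInMeasure_iff_dist, Metric.tendsto_nhds]
  simp only [eventually_inProbability_iff, not_lt, gt_iff_lt]

/-- Lets almost sure regularity of paths, valid for large samples, be used as an eventual property
along the filter. -/
theorem eventually_inProbability_of_ae {P : Measure Ω} {l : Filter ι} {p : ι × Ω → Prop}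
    (h : ∀ᶠ m in l, ∀ᵐ ω ∂P, p (m, ω)) : ∀ᶠ x in inProbability P l, p x := by
  rw [eventually_inProbability_iff]
  refine tendsto_const_nhds.congr' ?_
  filter_upwards [h] with m hm
  exact (ae_iff.1 hm).symm

theorem tendsto_fst_inProbability {P : Measure Ω} {l : Filter ι} :
    Tendsto Prod.fst (inProbability P l) l := by
  intro S hS
  refine eventually_inProbability_of_ae (p := fun x => x.1 ∈ S) ?_
  filter_upwards [hS] with m hm
  exact ae_of_all _ fun _ => hm

/-- Markov's inequality: nonnegative variables whose means tend to `0` tend to `0` in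
probability. -/
theorem tendsto_inProbability_zero_of_tendsto_integral {P : Measure Ω} [IsFiniteMeasure P]
    {l : Filter ι} {X : ι → Ω → ℝ} (h0 : ∀ m ω, 0 ≤ X m ω) (hi : ∀ᶠ m in l, Integrable (X m) P)
    (hX : Tendsto (fun m => ∫ ω, X m ω ∂P) l (𝓝 0)) :
    Tendsto (fun x : ι × Ω => X x.1 x.2) (inProbability P l) (𝓝 0) := by
  rw [← tendstoInMeasure_const_iff_tendsto_inProbability, tendstoInMeasure_iff_measureReal_dist]
  intro ε hε
  have h := hX.const_mul ε⁻¹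
  rw [mul_zero] at h
  refine tendsto_of_tendsto_of_tendsto_of_le_of_le' tendsto_const_nhds h
    (Eventually.of_forall fun _ => measureReal_nonneg) ?_
  filter_upwards [hi] with m hm
  have := mul_meas_ge_le_integral_of_nonneg (ae_of_all _ (h0 m)) hm ε
  have e : {ω | ε ≤ dist (X m ω) 0} = {ω | ε ≤ X m ω} := by
    ext ω; simp [abs_of_nonneg (h0 m ω)]
  rw [e, inv_mul_eq_div, le_div_iff₀ hε, mul_comm]
  exact this

end MeasureTheory

/-! ### Chi-square critical values depend continuously on the degrees of freedom -/

namespace ECF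

theorem isProbabilityMeasure_chiSq {d : ℝ} (hd : 0 < d) : IsProbabilityMeasure (chiSq d) :=
  isProbabilityMeasure_gammaMeasure (by positivity) (by norm_num)

theorem integrable_gammaPDFReal {s r : ℝ} (hs : 0 < s) (hr : 0 < r) :
    Integrable (gammaPDFReal s r) := by
  refine ⟨(measurable_gammaPDFReal s r).aestronglyMeasurable, ?_⟩
  rw [hasFiniteIntegral_iff_ofReal (ae_of_all _ fun x => gammaPDFReal_nonneg hs hr x)]
  have := lintegral_gammaPDF_eq_one hs hr
  simp only [gammaPDF] at this
  simp [this]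

theorem gammaPDFReal_eq_mul (s r x : ℝ) :
    gammaPDFReal s r x =
      r ^ s / Real.Gamma s * (if 0 ≤ x then x ^ (s - 1) * Real.exp (-(r * x)) else 0) := by
  unfold gammaPDFReal
  split_ifs <;> ring

theorem continuousAt_integral_gammaPDFReal {s r : ℝ} (hs : 0 < s) (hr : 0 < r) (q : ℝ) :
    ContinuousAt (fun c => ∫ x in Set.Iic q, gammaPDFReal c r x) s := by
  simp only [gammaPDFReal_eq_mul, integral_const_mul]
  have hG : Real.Gamma s ≠ 0 := (Real.Gamma_pos_of_pos hs).ne'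
  have hGc : ContinuousAt Real.Gamma s :=
    (Real.differentiableAt_Gamma fun m h => by
      have : (0 : ℝ) ≤ m := m.cast_nonneg
      linarith).continuousAt
  refine ContinuousAt.mul (((Real.continuous_const_rpow hr.ne').continuousAt).div hGc hG) ?_
  have key : ∀ c : ℝ, 0 < c → Integrable
      (fun x : ℝ => if 0 ≤ x then x ^ (c - 1) * Real.exp (-(r * x)) else 0) := by
    intro c hc
    have h := (integrable_gammaPDFReal hc hr).const_mul (r ^ c / Real.Gamma c)⁻¹
    refine h.congr (ae_of_all _ fun x => ?_)
    have : r ^ c / Real.Gamma c ≠ 0 :=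
      (div_pos (Real.rpow_pos_of_pos hr c) (Real.Gamma_pos_of_pos hc)).ne'
    simp only [gammaPDFReal_eq_mul]
    rw [inv_mul_cancel_left₀ this]
  -- For shapes `c` in `(s/2, 2s)`, the power `x ^ (c - 1)` is at most `x ^ (2s - 1)` when `x ≥ 1`
  -- and at most `x ^ (s/2 - 1)` when `x ≤ 1`; the sum dominates both cases.
  refine continuousAt_of_dominated
    (bound := fun x => (if 0 ≤ x then x ^ (s / 2 - 1) * Real.exp (-(r * x)) else 0) +
      (if 0 ≤ x then x ^ (2 * s - 1) * Real.exp (-(r * x)) else 0)) ?_ ?_ ?_ ?_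
  · filter_upwards [lt_mem_nhds hs] with c hc
    exact (key c hc).aestronglyMeasurable.restrict
  · filter_upwards [Ioo_mem_nhds (show s / 2 < s by linarith) (show s < 2 * s by linarith)]
      with c hc
    refine ae_restrict_of_ae ?_
    filter_upwards [measure_eq_zero_iff_ae_notMem.1 (Real.volume_singleton (a := 0))] with x hx
    by_cases h : 0 ≤ x
    · have hx0 : 0 < x := lt_of_le_of_ne h (fun e => hx (by simp [e]))
      simp only [if_pos h]
      rw [Real.norm_of_nonneg (by positivity), ← add_mul]
      refine mul_le_mul_of_nonneg_right ?_ (Real.exp_pos _).le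
      rcases le_total 1 x with h1 | h1
      · have := Real.rpow_le_rpow_of_exponent_le h1 (show c - 1 ≤ 2 * s - 1 by linarith [hc.2])
        have := Real.rpow_nonneg h (s / 2 - 1)
        linarith
      · have := Real.rpow_le_rpow_of_exponent_ge hx0 h1
          (show s / 2 - 1 ≤ c - 1 by linarith [hc.1])
        have := Real.rpow_nonneg h (2 * s - 1)
        linarith
    · simp [h]
  · exact ((key _ (by positivity)).add (key _ (by positivity))).restrict
  · refine ae_restrict_of_ae ?_
    -- As a function of `c`, `0 ^ (c - 1)` jumps at `c = 1`, so the null point `0` is discarded.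
    filter_upwards [measure_eq_zero_iff_ae_notMem.1 (Real.volume_singleton (a := 0))] with x hx
    by_cases h : 0 ≤ x
    · have hx0 : x ≠ 0 := fun e => hx (by simp [e])
      simp only [if_pos h]
      refine ContinuousAt.mul ?_ continuousAt_const
      exact (Real.continuousAt_const_rpow hx0).comp (by fun_prop)
    · simp only [if_neg h]; exact continuousAt_const

theorem chiSq_real_Ioi {d : ℝ} (hd : 0 < d) (q : ℝ) :
    (chiSq d).real (Set.Ioi q) = 1 - ∫ x in Set.Iic q, gammaPDFReal (d / 2) (1 / 2) x := by
  have := isProbabilityMeasure_chiSq hd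
  rw [← cdf_gammaMeasure_eq_integral (by positivity) (by norm_num), ← Set.compl_Iic,
    probReal_compl_eq_one_sub measurableSet_Iic]
  change _ = 1 - cdf (chiSq d) q
  rw [cdf_eq_real]

theorem chiSq_real_Ioi_continuousAt {d : ℝ} (hd : 0 < d) (q : ℝ) :
    ContinuousAt (fun c => (chiSq c).real (Set.Ioi q)) d := by
  have h1 : ContinuousAt (fun c : ℝ => ∫ x in Set.Iic q, gammaPDFReal (c / 2) (1 / 2) x) d :=
    ContinuousAt.comp (f := fun c : ℝ => c / 2)
      (continuousAt_integral_gammaPDFReal (by positivity) (by norm_num) q) (by fun_prop)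
  refine (continuousAt_const.sub h1 :
    ContinuousAt (fun c : ℝ => 1 - ∫ x in Set.Iic q, gammaPDFReal (c / 2) (1 / 2) x) d).congr ?_
  filter_upwards [lt_mem_nhds hd] with c hc
  exact (chiSq_real_Ioi hc q).symm

theorem chiSq_real_Ioi_of_nonpos {d : ℝ} (hd : 0 < d) {q : ℝ} (hq : q ≤ 0) :
    (chiSq d).real (Set.Ioi q) = 1 := by
  rw [chiSq_real_Ioi hd, ← integral_Iic_eq_integral_Iio.symm, setIntegral_eq_zero_of_forall_eq_zero,
    sub_zero]
  intro x hx
  exact if_neg (not_le.2 (lt_of_lt_of_le hx hq))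

theorem chiSq_real_Ioi_antitone {d : ℝ} (hd : 0 < d) :
    Antitone fun q => (chiSq d).real (Set.Ioi q) := by
  have := isProbabilityMeasure_chiSq hd
  exact fun q q' h => measureReal_mono (Set.Ioi_subset_Ioi h)

/-- The density is positive on `(0, ∞)`. To the left of `0` the tail is constantly `1`, hence the
restriction. -/
theorem chiSq_real_Ioi_strictAntiOn {d : ℝ} (hd : 0 < d) :
    StrictAntiOn (fun q => (chiSq d).real (Set.Ioi q)) (Set.Ici 0) := by
  intro q hq q' _ h
  simp only [chiSq_real_Ioi hd]
  have hi := integrable_gammaPDFReal (show 0 < d / 2 by positivity) (show (0 : ℝ) < 1 / 2 by norm_num)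
  have e : ∫ x in Set.Iic q', gammaPDFReal (d / 2) (1 / 2) x =
      (∫ x in Set.Iic q, gammaPDFReal (d / 2) (1 / 2) x) +
        ∫ x in Set.Ioc q q', gammaPDFReal (d / 2) (1 / 2) x := by
    rw [← setIntegral_union (Set.Iic_disjoint_Ioc le_rfl) measurableSet_Ioc hi.integrableOn
      hi.integrableOn, Set.Iic_union_Ioc_eq_Iic h.le]
  have pos : 0 < ∫ x in Set.Ioc q q', gammaPDFReal (d / 2) (1 / 2) x := by
    rw [← intervalIntegral.integral_of_le h.le]
    refine intervalIntegral.intervalIntegral_pos_of_pos_on hi.intervalIntegrable ?_ h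
    intro x hx
    exact gammaPDFReal_pos (by positivity) (by norm_num) (lt_of_le_of_lt hq hx.1)
  linarith

theorem nonempty_chiSq_real_Ioi_le {d α : ℝ} (hd : 0 < d) (hα : 0 < α) :
    {q : ℝ | (chiSq d).real (Set.Ioi q) ≤ α}.Nonempty := by
  have := isProbabilityMeasure_chiSq hd
  have h := (tendsto_cdf_atTop (chiSq d)).eventually (lt_mem_nhds (show 1 - α < 1 by linarith))
  obtain ⟨q, hq⟩ := h.exists
  refine ⟨q, ?_⟩
  rw [cdf_eq_real] at hq
  rw [Set.mem_ofPred_eq, ← Set.compl_Iic, probReal_compl_eq_one_sub measurableSet_Iic]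
  linarith

theorem bddBelow_chiSq_real_Ioi_le {d α : ℝ} (hd : 0 < d) (hα : α < 1) :
    BddBelow {q : ℝ | (chiSq d).real (Set.Ioi q) ≤ α} := by
  refine ⟨0, fun q hq => ?_⟩
  by_contra h
  have := chiSq_real_Ioi_of_nonpos hd (not_le.1 h).le
  rw [Set.mem_ofPred_eq] at hq
  linarith

/-- The tail at `d` crosses the level `α` strictly at `q₀`. The strict inequalities at `q₀ ± ε/2`
survive for `c` near `d` by continuity of the tail in `c`, and monotonicity in `q` traps the
percentile of `c` between these points. -/
theorem chiSqUpper_continuousAt {d α : ℝ} (hd : 0 < d) (hα : α ∈ Set.Ioo (0 : ℝ) 1) :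
    ContinuousAt (fun c => chiSqUpper c α) d := by
  set q₀ := chiSqUpper d α with hq₀
  have hlow : ∀ q < q₀, α < (chiSq d).real (Set.Ioi q) := by
    intro q hq
    by_contra h
    exact absurd (csInf_le (bddBelow_chiSq_real_Ioi_le hd hα.2) (not_lt.1 h)) (not_le.2 hq)
  have hupp : ∀ q > q₀, (chiSq d).real (Set.Ioi q) < α := by
    intro q hq
    obtain ⟨q', hq', hlt⟩ := exists_lt_of_csInf_lt (nonempty_chiSq_real_Ioi_le hd hα.1) hq
    have hq'0 : 0 ≤ q' := by
      by_contra h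
      have := chiSq_real_Ioi_of_nonpos hd (not_le.1 h).le
      rw [Set.mem_ofPred_eq] at hq'
      linarith [hα.2]
    exact (chiSq_real_Ioi_strictAntiOn hd hq'0 (hq'0.trans hlt.le) hlt).trans_le hq'
  rw [Metric.continuousAt_iff']
  intro ε hε
  filter_upwards [lt_mem_nhds hd,
    (chiSq_real_Ioi_continuousAt hd (q₀ - ε / 2)).eventually
      (lt_mem_nhds (hlow (q₀ - ε / 2) (by linarith))),
    (chiSq_real_Ioi_continuousAt hd (q₀ + ε / 2)).eventually
      (gt_mem_nhds (hupp (q₀ + ε / 2) (by linarith)))] with c hc h1 h2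
  have hle : chiSqUpper c α ≤ q₀ + ε / 2 := csInf_le (bddBelow_chiSq_real_Ioi_le hc hα.2) h2.le
  have hge : q₀ - ε / 2 ≤ chiSqUpper c α := by
    refine le_csInf (nonempty_chiSq_real_Ioi_le hc hα.1) fun q hq => ?_
    by_contra h
    have := chiSq_real_Ioi_antitone hc (not_le.1 h).le
    rw [Set.mem_ofPred_eq] at hq
    dsimp only at this
    linarith
  rw [Real.dist_eq, abs_lt]
  constructor <;> linarith

end ECF

/-! ### Fourth moments of Gaussian vectors -/

namespace ECF

/-- The moment is the fourth derivative at `0` of the moment generating function `exp (v t² / 2)`;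
each derivative is a polynomial times the same exponential. -/
theorem integral_pow_four_gaussianReal (v : NNReal) :
    ∫ x, x ^ 4 ∂gaussianReal 0 v = 3 * (v : ℝ) ^ 2 := by
  have h4 : ∫ x, x ^ 4 ∂gaussianReal 0 v =
      iteratedDeriv 4 (mgf (fun x ↦ x) (gaussianReal 0 v)) 0 := by
    rw [iteratedDeriv_mgf_zero] <;> simp
  have hstep : ∀ (p p' : ℝ → ℝ), (∀ t, HasDerivAt p (p' t) t) →
      deriv (fun t => p t * Real.exp (v * t ^ 2 / 2)) =
        fun t => (p' t + v * t * p t) * Real.exp (v * t ^ 2 / 2) := by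
    intro p p' hp
    ext t
    have h1 : HasDerivAt (fun t : ℝ => (v : ℝ) * t ^ 2 / 2) (v * t) t := by
      have := (((hasDerivAt_id t).pow 2).const_mul (v : ℝ)).div_const 2
      simp only [id] at this
      refine this.congr_deriv ?_
      norm_num
      ring
    have := ((hp t).mul h1.exp).deriv
    refine Eq.trans this ?_
    ring
  have e0 : mgf (fun x ↦ x) (gaussianReal 0 v) =
      fun t => (fun _ => (1 : ℝ)) t * Real.exp (v * t ^ 2 / 2) := by
    rw [mgf_fun_id_gaussianReal]; simp
  rw [h4, e0]
  simp only [iteratedDeriv_succ, iteratedDeriv_zero]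
  -- The successive polynomial factors are `1`, `v t`, `v + v² t²`, `3v² t + v³ t³`; the next one
  -- takes the value `3v²` at `0`.
  rw [hstep _ (fun _ => 0) (fun t => hasDerivAt_const t 1),
    hstep (fun t => 0 + v * t * 1) (fun _ => v) ?_,
    hstep (fun t => v + v * t * (0 + v * t * 1)) (fun t => 2 * v ^ 2 * t) ?_,
    hstep (fun t => 2 * v ^ 2 * t + v * t * (v + v * t * (0 + v * t * 1)))
      (fun t => 3 * v ^ 2 + 3 * v ^ 3 * t ^ 2) ?_]
  · simp
  · intro t
    have := ((hasDerivAt_id t).const_mul (3 * (v : ℝ) ^ 2)).add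
      (((hasDerivAt_id t).pow 3).const_mul ((v : ℝ) ^ 3))
    simp only [id] at this
    refine (this.congr_deriv ?_).congr_of_eventuallyEq (Eventually.of_forall fun s => ?_)
    · norm_num; ring
    · simp; ring
  · intro t
    have := (hasDerivAt_const t (v : ℝ)).add (((hasDerivAt_id t).pow 2).const_mul ((v : ℝ) ^ 2))
    simp only [id] at this
    refine (this.congr_deriv ?_).congr_of_eventuallyEq (Eventually.of_forall fun s => ?_)
    · norm_num; ring
    · simp; ring
  · intro t
    have := ((hasDerivAt_id t).const_mul (v : ℝ))
    simp only [id] at this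
    refine (this.congr_deriv ?_).congr_of_eventuallyEq (Eventually.of_forall fun s => ?_)
    · ring
    · simp

variable {Ω : Type*} [MeasurableSpace Ω] {P : Measure Ω}

theorem integrable_pow_four_of_hasGaussianLaw {X : Ω → ℝ} (hX : HasGaussianLaw X P) :
    Integrable (fun ω => X ω ^ 4) P := by
  have := hX.isProbabilityMeasure
  refine (MemLp.integrable_norm_pow (hX.memLp (p := (4 : ℕ)) (by simp)) (by simp)).congr
    (ae_of_all _ fun ω => ?_)
  dsimp only
  rw [Real.norm_eq_abs, Even.pow_abs (by decide)]

theorem integral_pow_four_of_hasGaussianLaw {X : Ω → ℝ} (hX : HasGaussianLaw X P)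
    (h0 : P[X] = 0) : ∫ ω, X ω ^ 4 ∂P = 3 * (∫ ω, X ω ^ 2 ∂P) ^ 2 := by
  have := hX.isProbabilityMeasure
  have h := hX.map_eq_gaussianReal
  have e : ∫ ω, X ω ^ 4 ∂P = ∫ x, x ^ 4 ∂(P.map X) :=
    (integral_map hX.aemeasurable (f := fun x => x ^ 4) (by fun_prop)).symm
  rw [e, h, h0, integral_pow_four_gaussianReal, Real.coe_toNNReal _ (variance_nonneg _ _),
    variance_of_integral_eq_zero hX.aemeasurable h0]

/-! ### Isserlis' formula by polarization -/

section FourGaussians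

variable {A B C D : Ω → ℝ}

/-- Weighting the fourth powers by the product of their signs kills every monomial except `xyzw`,
which occurs with coefficient `24` in each of `8` terms. Fourth moments of linear combinations thus
determine mixed ones. -/
theorem mul_mul_mul_eq_polarization (x y z w : ℝ) :
    x * y * z * w = 1 / 192 * (
      (x + y + z + w) ^ 4 - (x + y + z - w) ^ 4 - (x + y - z + w) ^ 4 + (x + y - z - w) ^ 4
      - (x - y + z + w) ^ 4 + (x - y + z - w) ^ 4 + (x - y - z + w) ^ 4
      - (x - y - z - w) ^ 4) := by ring

theorem integrable_mul_mul_mul_of_hasGaussianLaw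
    (h : ∀ e₁ e₂ e₃ e₄ : ℝ,
      HasGaussianLaw (fun ω => e₁ * A ω + e₂ * B ω + e₃ * C ω + e₄ * D ω) P) :
    Integrable (fun ω => A ω * B ω * C ω * D ω) P := by
  simp only [mul_mul_mul_eq_polarization]
  have hp : ∀ e₁ e₂ e₃ e₄ : ℝ,
      Integrable (fun ω => (e₁ * A ω + e₂ * B ω + e₃ * C ω + e₄ * D ω) ^ 4) P :=
    fun e₁ e₂ e₃ e₄ => integrable_pow_four_of_hasGaussianLaw (h e₁ e₂ e₃ e₄)
  have := ((((((((hp 1 1 1 1).sub (hp 1 1 1 (-1))).sub (hp 1 1 (-1) 1)).add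
    (hp 1 1 (-1) (-1))).sub (hp 1 (-1) 1 1)).add (hp 1 (-1) 1 (-1))).add
    (hp 1 (-1) (-1) 1)).sub (hp 1 (-1) (-1) (-1))).const_mul (1 / 192)
  refine this.congr (ae_of_all _ fun ω => ?_)
  simp only [Pi.add_apply, Pi.sub_apply]
  ring

/-- Isserlis' formula for four centered jointly Gaussian variables. -/
theorem integral_mul_mul_mul_of_hasGaussianLaw
    (h : ∀ e₁ e₂ e₃ e₄ : ℝ,
      HasGaussianLaw (fun ω => e₁ * A ω + e₂ * B ω + e₃ * C ω + e₄ * D ω) P)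
    (hA : P[A] = 0) (hB : P[B] = 0) (hC : P[C] = 0) (hD : P[D] = 0) :
    ∫ ω, A ω * B ω * C ω * D ω ∂P =
      (∫ ω, A ω * B ω ∂P) * (∫ ω, C ω * D ω ∂P) + (∫ ω, A ω * C ω ∂P) * (∫ ω, B ω * D ω ∂P)
        + (∫ ω, A ω * D ω ∂P) * (∫ ω, B ω * C ω ∂P) := by
  have gA : HasGaussianLaw A P := by simpa using h 1 0 0 0
  have gB : HasGaussianLaw B P := by simpa using h 0 1 0 0
  have gC : HasGaussianLaw C P := by simpa using h 0 0 1 0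
  have gD : HasGaussianLaw D P := by simpa using h 0 0 0 1
  have := gA.isProbabilityMeasure
  have hmul : ∀ {X Y : Ω → ℝ}, HasGaussianLaw X P → HasGaussianLaw Y P →
      Integrable (fun ω => X ω * Y ω) P :=
    fun hX hY => hX.memLp_two.integrable_mul hY.memLp_two
  have hlin : ∀ e₁ e₂ e₃ e₄ : ℝ,
      P[fun ω => e₁ * A ω + e₂ * B ω + e₃ * C ω + e₄ * D ω] = 0 := by
    intro e₁ e₂ e₃ e₄
    rw [integral_add, integral_add, integral_add]
    · simp only [integral_const_mul, hA, hB, hC, hD]; simp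
    all_goals
      have := gA.integrable
      have := gB.integrable
      have := gC.integrable
      have := gD.integrable
      fun_prop
  have hquad : ∀ e₁ e₂ e₃ e₄ : ℝ,
      ∫ ω, (e₁ * A ω + e₂ * B ω + e₃ * C ω + e₄ * D ω) ^ 2 ∂P =
        e₁ ^ 2 * (∫ ω, A ω * A ω ∂P) + e₂ ^ 2 * (∫ ω, B ω * B ω ∂P)
        + e₃ ^ 2 * (∫ ω, C ω * C ω ∂P) + e₄ ^ 2 * (∫ ω, D ω * D ω ∂P)
        + 2 * e₁ * e₂ * (∫ ω, A ω * B ω ∂P) + 2 * e₁ * e₃ * (∫ ω, A ω * C ω ∂P)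
        + 2 * e₁ * e₄ * (∫ ω, A ω * D ω ∂P) + 2 * e₂ * e₃ * (∫ ω, B ω * C ω ∂P)
        + 2 * e₂ * e₄ * (∫ ω, B ω * D ω ∂P) + 2 * e₃ * e₄ * (∫ ω, C ω * D ω ∂P) := by
    intro e₁ e₂ e₃ e₄
    have e : ∀ ω, (e₁ * A ω + e₂ * B ω + e₃ * C ω + e₄ * D ω) ^ 2 =
        e₁ ^ 2 * (A ω * A ω) + e₂ ^ 2 * (B ω * B ω)
        + e₃ ^ 2 * (C ω * C ω) + e₄ ^ 2 * (D ω * D ω)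
        + 2 * e₁ * e₂ * (A ω * B ω) + 2 * e₁ * e₃ * (A ω * C ω)
        + 2 * e₁ * e₄ * (A ω * D ω) + 2 * e₂ * e₃ * (B ω * C ω)
        + 2 * e₂ * e₄ * (B ω * D ω) + 2 * e₃ * e₄ * (C ω * D ω) := fun ω => by ring
    simp only [e, ← integral_const_mul]
    have i1 := (hmul gA gA).const_mul (e₁ ^ 2)
    have i2 := (hmul gB gB).const_mul (e₂ ^ 2)
    have i3 := (hmul gC gC).const_mul (e₃ ^ 2)
    have i4 := (hmul gD gD).const_mul (e₄ ^ 2)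
    have i5 := (hmul gA gB).const_mul (2 * e₁ * e₂)
    have i6 := (hmul gA gC).const_mul (2 * e₁ * e₃)
    have i7 := (hmul gA gD).const_mul (2 * e₁ * e₄)
    have i8 := (hmul gB gC).const_mul (2 * e₂ * e₃)
    have i9 := (hmul gB gD).const_mul (2 * e₂ * e₄)
    have i10 := (hmul gC gD).const_mul (2 * e₃ * e₄)
    rw [integral_add, integral_add, integral_add, integral_add, integral_add, integral_add,
      integral_add, integral_add, integral_add]
    all_goals fun_prop
  have hquart : ∀ e₁ e₂ e₃ e₄ : ℝ,
      ∫ ω, (e₁ * A ω + e₂ * B ω + e₃ * C ω + e₄ * D ω) ^ 4 ∂P =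
        3 * (∫ ω, (e₁ * A ω + e₂ * B ω + e₃ * C ω + e₄ * D ω) ^ 2 ∂P) ^ 2 :=
    fun e₁ e₂ e₃ e₄ => integral_pow_four_of_hasGaussianLaw (h e₁ e₂ e₃ e₄) (hlin e₁ e₂ e₃ e₄)
  have hp : ∀ e₁ e₂ e₃ e₄ : ℝ,
      Integrable (fun ω => (e₁ * A ω + e₂ * B ω + e₃ * C ω + e₄ * D ω) ^ 4) P :=
    fun e₁ e₂ e₃ e₄ => integrable_pow_four_of_hasGaussianLaw (h e₁ e₂ e₃ e₄)
  -- Polarization again, with the signs written as coefficients so that `hquart` and `hquad` rewrite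
  -- every term.
  have e : ∀ ω, A ω * B ω * C ω * D ω = 1 / 192 * (
      (1 * A ω + 1 * B ω + 1 * C ω + 1 * D ω) ^ 4 - (1 * A ω + 1 * B ω + 1 * C ω + (-1) * D ω) ^ 4
      - (1 * A ω + 1 * B ω + (-1) * C ω + 1 * D ω) ^ 4
      + (1 * A ω + 1 * B ω + (-1) * C ω + (-1) * D ω) ^ 4
      - (1 * A ω + (-1) * B ω + 1 * C ω + 1 * D ω) ^ 4
      + (1 * A ω + (-1) * B ω + 1 * C ω + (-1) * D ω) ^ 4
      + (1 * A ω + (-1) * B ω + (-1) * C ω + 1 * D ω) ^ 4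
      - (1 * A ω + (-1) * B ω + (-1) * C ω + (-1) * D ω) ^ 4) := fun ω => by ring
  simp only [e, integral_const_mul]
  have i1 := hp 1 1 1 1
  have i2 := hp 1 1 1 (-1)
  have i3 := hp 1 1 (-1) 1
  have i4 := hp 1 1 (-1) (-1)
  have i5 := hp 1 (-1) 1 1
  have i6 := hp 1 (-1) 1 (-1)
  have i7 := hp 1 (-1) (-1) 1
  have i8 := hp 1 (-1) (-1) (-1)
  rw [integral_sub, integral_add, integral_add, integral_sub, integral_add, integral_sub,
    integral_sub]
  · simp only [hquart, hquad]
    ring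
  all_goals fun_prop

end FourGaussians

theorem hasGaussianLaw_four {ι : Type*} {X : ι → Ω → ℝ} (hX : IsGaussianProcess X P)
    (p q r s : ι) (e₁ e₂ e₃ e₄ : ℝ) :
    HasGaussianLaw (fun ω => e₁ * X p ω + e₂ * X q ω + e₃ * X r ω + e₄ * X s ω) P := by
  classical
  let I : Finset ι := {p, q, r, s}
  let L : (I → ℝ) →ₗ[ℝ] ℝ :=
    e₁ • LinearMap.proj ⟨p, by simp [I]⟩ + e₂ • LinearMap.proj ⟨q, by simp [I]⟩ +
      e₃ • LinearMap.proj ⟨r, by simp [I]⟩ + e₄ • LinearMap.proj ⟨s, by simp [I]⟩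
  exact (hX.hasGaussianLaw I).map_fun L.toContinuousLinearMap

section CenteredProcess

variable {ι : Type*} {X : ι → Ω → ℝ}

theorem memLp_mul_of_isGaussianProcess (hX : IsGaussianProcess X P) (p q : ι) :
    MemLp (fun ω => X p ω * X q ω) 2 P := by
  have hm : AEStronglyMeasurable (fun ω => X p ω * X q ω) P :=
    ((hX.aemeasurable p).mul (hX.aemeasurable q)).aestronglyMeasurable
  rw [memLp_two_iff_integrable_sq hm]
  refine (integrable_mul_mul_mul_of_hasGaussianLaw (hasGaussianLaw_four hX p q p q)).congr
    (ae_of_all _ fun ω => ?_)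
  ring

/-- Of the three pairings in Isserlis' formula, `(pq)(rs)` is cancelled by the product of the means.
-/
theorem covariance_mul_mul_of_isGaussianProcess (hX : IsGaussianProcess X P)
    (h0 : ∀ p, P[X p] = 0) (p q r s : ι) :
    cov[fun ω => X p ω * X q ω, fun ω => X r ω * X s ω; P] =
      cov[X p, X r; P] * cov[X q, X s; P] + cov[X p, X s; P] * cov[X q, X r; P] := by
  have := hX.isProbabilityMeasure
  have hc : ∀ p q, cov[X p, X q; P] = ∫ ω, X p ω * X q ω ∂P := by
    intro p q
    rw [covariance_eq_sub (hX.hasGaussianLaw_eval p).memLp_two (hX.hasGaussianLaw_eval q).memLp_two,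
      h0, h0]
    simp
  rw [covariance_eq_sub (memLp_mul_of_isGaussianProcess hX p q)
    (memLp_mul_of_isGaussianProcess hX r s)]
  have e : P[(fun ω => X p ω * X q ω) * fun ω => X r ω * X s ω] =
      ∫ ω, X p ω * X q ω * X r ω * X s ω ∂P :=
    integral_congr_ae (ae_of_all _ fun ω => by simp only [Pi.mul_apply]; ring)
  rw [e, integral_mul_mul_mul_of_hasGaussianLaw (hasGaussianLaw_four hX p q r s)
    (h0 p) (h0 q) (h0 r) (h0 s)]
  simp only [hc]
  ring

end CenteredProcess

/-- Independent Gaussian processes are jointly Gaussian. -/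
theorem isGaussianProcess_of_iIndepFun {ι T : Type*} {X : ι → T → Ω → ℝ}
    (hX : ∀ i, IsGaussianProcess (X i) P) (hi : iIndepFun (fun i ω t => X i t ω) P) :
    IsGaussianProcess (fun (p : ι × T) => X p.1 p.2) P where
  hasGaussianLaw I := by
    classical
    -- The finite set `I` lies in the rectangle `J × S`; independence gives joint normality there,
    -- and `L` reads off the coordinates in `I`.
    let J := I.image Prod.fst
    let S := I.image Prod.snd
    have h1 : ∀ i : J, HasGaussianLaw (fun ω => S.restrict (X i · ω)) P :=
      fun i => (hX i).hasGaussianLaw S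
    have h2 : iIndepFun (fun (i : J) ω => S.restrict (X i · ω)) P := by
      have := (hi.precomp (Subtype.val_injective (p := fun i => i ∈ J))).comp
        (fun _ f => S.restrict f) (fun _ => by fun_prop)
      exact this
    have h3 := iIndepFun.hasGaussianLaw h1 h2
    let L : (J → S → ℝ) →ₗ[ℝ] (I → ℝ) :=
      { toFun f p := f ⟨p.1.1, Finset.mem_image_of_mem _ p.2⟩
          ⟨p.1.2, Finset.mem_image_of_mem _ p.2⟩
        map_add' _ _ := rfl
        map_smul' _ _ := rfl }
    exact h3.map_fun L.toContinuousLinearMap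

end ECF

/-! ### Mean and covariance of the pooled sample covariance function -/

namespace ECF

variable {a b : ℝ} {k : ℕ}

/-- Within-group residual `v_{ij}(t) - v̄_i(t)`, indexed by `(i, j)` and `t`. -/
noncomputable def residual {Ω : Type*} (N : Fin k → ℕ) (v : Fin k → ℕ → Time a b → Ω → ℝ)
    (q : (Σ _ : Fin k, ℕ) × Time a b) (ω : Ω) : ℝ :=
  v q.1.1 q.1.2 q.2 ω - (N q.1.1 : ℝ)⁻¹ * ∑ l ∈ Finset.range (N q.1.1), v q.1.1 l q.2 ω

/-- The pairs `(i, j)` with `j < N i`. -/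
def groupIndices (N : Fin k → ℕ) : Finset (Σ _ : Fin k, ℕ) :=
  Finset.univ.sigma fun i => Finset.range (N i)

/-- Correlation of the residuals `p` and `q`. -/
noncomputable def residualCorr (N : Fin k → ℕ) (p q : Σ _ : Fin k, ℕ) : ℝ :=
  if p.1 = q.1 then (if p.2 = q.2 then 1 else 0) - (N p.1 : ℝ)⁻¹ else 0

theorem dof_eq_sum (N : Fin k → ℕ) : dof N = ∑ i, ((N i : ℝ) - 1) := by
  simp [dof, total]

theorem dof_pos [NeZero k] {N : Fin k → ℕ} (hN : ∀ i, 2 ≤ N i) : 0 < dof N := by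
  rw [dof_eq_sum]
  refine Finset.sum_pos (fun i _ => ?_) ⟨0, Finset.mem_univ _⟩
  have : (2 : ℝ) ≤ N i := by exact_mod_cast hN i
  linarith

theorem sum_residualCorr_diag {N : Fin k → ℕ} (hN : ∀ i, 2 ≤ N i) :
    ∑ p ∈ groupIndices N, residualCorr N p p = dof N := by
  rw [dof_eq_sum, groupIndices, Finset.sum_sigma]
  refine Finset.sum_congr rfl fun i _ => ?_
  have : (N i : ℝ) ≠ 0 := by
    have := hN i
    positivity
  simp only [residualCorr, if_true, Finset.sum_const, Finset.card_range, nsmul_eq_mul]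
  field_simp

/-- Each diagonal block is the centering projection `I - 11ᵀ/N_i`, symmetric and idempotent, so its
squared Frobenius norm is its rank `N_i - 1`. -/
theorem sum_residualCorr_sq {N : Fin k → ℕ} (hN : ∀ i, 2 ≤ N i) :
    ∑ p ∈ groupIndices N, ∑ q ∈ groupIndices N, residualCorr N p q ^ 2 = dof N := by
  rw [dof_eq_sum, groupIndices, Finset.sum_sigma]
  refine Finset.sum_congr rfl fun i _ => ?_
  have h0 : (N i : ℝ) ≠ 0 := by
    have := hN i
    positivity
  have h1 : ∀ j ∈ Finset.range (N i),
      ∑ q ∈ Finset.univ.sigma fun i => Finset.range (N i),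
        residualCorr N ⟨i, j⟩ q ^ 2 = 1 - (N i : ℝ)⁻¹ := by
    intro j hj
    rw [Finset.sum_sigma, Finset.sum_eq_single i]
    · have : ∀ l, residualCorr N ⟨i, j⟩ ⟨i, l⟩ ^ 2 =
          (if j = l then 1 - 2 * (N i : ℝ)⁻¹ else 0) + (N i : ℝ)⁻¹ ^ 2 := by
        intro l
        simp only [residualCorr, if_true]
        split_ifs <;> ring
      simp only [this, Finset.sum_add_distrib, Finset.sum_ite_eq, if_pos hj, Finset.sum_const,
        Finset.card_range, nsmul_eq_mul]
      field_simp
      ring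
    · intro i' _ hi'
      simp [residualCorr, Ne.symm hi']
    · simp
  rw [Finset.sum_congr rfl h1]
  simp only [Finset.sum_const, Finset.card_range, nsmul_eq_mul]
  field_simp

/-- Centering removes `η_i`, and the weight `N_i - 1` cancels the normalization of the group
covariance. -/
theorem pooledCov_eq_sum_residual {Ω : Type*} {η : Fin k → Time a b → ℝ} {N : Fin k → ℕ}
    (hN : ∀ i, 2 ≤ N i) {v y : Fin k → ℕ → Time a b → Ω → ℝ}
    (hy : ∀ i j t ω, y i j t ω = η i t + v i j t ω) (ω : Ω) (s t : Time a b) :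
    pooledCov N (curves y ω) s t =
      (dof N)⁻¹ * ∑ p ∈ groupIndices N, residual N v (p, s) ω * residual N v (p, t) ω := by
  rw [pooledCov, div_eq_inv_mul, groupIndices, Finset.sum_sigma]
  congr 1
  refine Finset.sum_congr rfl fun i _ => ?_
  have h2 : (2 : ℝ) ≤ N i := by exact_mod_cast hN i
  have h1 : (N i : ℝ) - 1 ≠ 0 := by linarith
  have h0 : (N i : ℝ) ≠ 0 := by linarith
  have hr : ∀ j t, curves y ω i j t - sampleMean (N i) (curves y ω i) t =
      residual N v (⟨i, j⟩, t) ω := by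
    intro j t
    simp only [curves, sampleMean, residual, hy, Finset.sum_add_distrib, Finset.sum_const,
      Finset.card_range, nsmul_eq_mul]
    field_simp
    ring
  rw [sampleCov, mul_inv_cancel_left₀ h1]
  exact Finset.sum_congr rfl fun j _ => by rw [hr, hr]

section Model

variable {Ω : Type*} [MeasurableSpace Ω] {P : Measure Ω} {η : Fin k → Time a b → ℝ} {γ : Fin k → Time a b → Time a b → ℝ}
  {v y : Fin k → ℕ → Time a b → Ω → ℝ} {γ₀ : Time a b → Time a b → ℝ}

theorem IsFunctionalSamples.isGaussianProcess_residual (h : IsFunctionalSamples P η γ v y)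
    (hG : ∀ i j, IsGaussianProcess (v i j) P) (N : Fin k → ℕ) :
    IsGaussianProcess (residual N v) P := by
  classical
  have hV := isGaussianProcess_of_iIndepFun (X := fun p : Fin k × ℕ => v p.1 p.2)
    (fun p => hG p.1 p.2) h.indep
  refine hV.of_isGaussianProcess fun q => ?_
  -- The curve `(i, j)` is inserted separately, since `j` is arbitrary and may lie outside the
  -- sample.
  let I : Finset ((Fin k × ℕ) × Time a b) :=
    insert ((q.1.1, q.1.2), q.2) ((Finset.range (N q.1.1)).image fun l => ((q.1.1, l), q.2))
  let L : (I → ℝ) →ₗ[ℝ] ℝ :=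
    LinearMap.proj (⟨_, Finset.mem_insert_self _ _⟩ : I) -
      (N q.1.1 : ℝ)⁻¹ • ∑ l : Finset.range (N q.1.1),
        LinearMap.proj (⟨((q.1.1, l.1), q.2),
          Finset.mem_insert_of_mem (Finset.mem_image_of_mem _ l.2)⟩ : I)
  refine ⟨I, L.toContinuousLinearMap, fun ω => ?_⟩
  have e : ∑ l ∈ Finset.range (N q.1.1), v q.1.1 l q.2 ω =
      ∑ l : Finset.range (N q.1.1), v q.1.1 l.1 q.2 ω := (Finset.sum_coe_sort _ _).symm
  simp [L, residual, e]

theorem IsFunctionalSamples.integral_residual [IsProbabilityMeasure P]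
    (h : IsFunctionalSamples P η γ v y) (N : Fin k → ℕ) (q : (Σ _ : Fin k, ℕ) × Time a b) :
    P[residual N v q] = 0 := by
  have hi : ∀ i j t, Integrable (v i j t) P := fun i j t => (h.memLp i j t).integrable (by simp)
  simp only [residual]
  rw [integral_sub (hi _ _ _) ((integrable_finsetSum _ fun l _ => hi _ l _).const_mul _),
    integral_const_mul, integral_finsetSum _ fun l _ => hi _ l _]
  simp [h.centered]

theorem IsFunctionalSamples.covariance_eq_ite [IsProbabilityMeasure P]
    (h : IsFunctionalSamples P η γ v y)
    (hγ : ∀ i s t, γ i s t = γ₀ s t) (i j i' j') (s t : Time a b) :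
    cov[v i j s, v i' j' t; P] = if i = i' ∧ j = j' then γ₀ s t else 0 := by
  split_ifs with hp
  · rw [← hp.1, ← hp.2, h.covariance_eq, hγ]
  · have hne : ((i, j) : Fin k × ℕ) ≠ (i', j') := by simpa using hp
    have hs : Measurable fun f : Time a b → ℝ => f s := measurable_pi_apply s
    have ht : Measurable fun f : Time a b → ℝ => f t := measurable_pi_apply t
    exact IndepFun.covariance_eq_zero ((h.indep.indepFun hne).comp hs ht)
      (h.memLp i j s) (h.memLp i' j' t)

theorem IsFunctionalSamples.covariance_residual [IsProbabilityMeasure P]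
    (h : IsFunctionalSamples P η γ v y)
    (hγ : ∀ i s t, γ i s t = γ₀ s t) {N : Fin k → ℕ} {p q : Σ _ : Fin k, ℕ}
    (hp : p ∈ groupIndices N) (hq : q ∈ groupIndices N) (s t : Time a b) :
    cov[residual N v (p, s), residual N v (q, t); P] = residualCorr N p q * γ₀ s t := by
  obtain ⟨i, j⟩ := p
  obtain ⟨i', j'⟩ := q
  have hj : j < N i := by simpa [groupIndices] using hp
  have hj' : j' < N i' := by simpa [groupIndices] using hq
  have hN0 : (N i : ℝ) ≠ 0 := by
    have : 0 < N i := by omega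
    positivity
  have hm : ∀ i t, MemLp (fun ω => ∑ l ∈ Finset.range (N i), v i l t ω) 2 P :=
    fun i t => memLp_finsetSum _ fun l _ => h.memLp i l t
  unfold residual
  rw [covariance_fun_sub_fun_sub (h.memLp _ _ _) ((hm _ _).const_mul _) (h.memLp _ _ _)
      ((hm _ _).const_mul _), covariance_const_mul_left, covariance_const_mul_right,
    covariance_const_mul_left, covariance_const_mul_right,
    covariance_fun_sum_right' (fun l _ => h.memLp _ l _) (h.memLp _ _ _),
    covariance_fun_sum_left' (fun l _ => h.memLp _ l _) (h.memLp _ _ _),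
    covariance_fun_sum_fun_sum' (fun l _ => h.memLp _ l _) (fun l _ => h.memLp _ l _)]
  simp only [h.covariance_eq_ite hγ, residualCorr]
  by_cases hi : i = i'
  · subst hi
    simp only [true_and, Finset.sum_ite_eq, Finset.sum_ite_eq', Finset.mem_range, hj, hj', if_true]
    rw [Finset.sum_congr rfl fun l hl => if_pos (Finset.mem_range.1 hl)]
    simp only [Finset.sum_const, Finset.card_range, nsmul_eq_mul]
    split_ifs
    · field_simp
      ring
    · field_simp
      ring
  · simp [hi]

theorem IsFunctionalSamples.integral_pooledCov [NeZero k] [IsProbabilityMeasure P]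
    (h : IsFunctionalSamples P η γ v y) (hG : ∀ i j, IsGaussianProcess (v i j) P)
    (hγ : ∀ i s t, γ i s t = γ₀ s t) {N : Fin k → ℕ} (hN : ∀ i, 2 ≤ N i) (s t : Time a b) :
    ∫ ω, pooledCov N (curves y ω) s t ∂P = γ₀ s t := by
  have hR := h.isGaussianProcess_residual hG N
  simp only [pooledCov_eq_sum_residual hN h.model]
  rw [integral_const_mul, integral_finsetSum _ fun p _ =>
    (memLp_mul_of_isGaussianProcess hR (p, s) (p, t)).integrable (by simp)]
  have : ∀ p ∈ groupIndices N, ∫ ω, residual N v (p, s) ω * residual N v (p, t) ω ∂P =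
      residualCorr N p p * γ₀ s t := by
    intro p hp
    rw [← h.covariance_residual hγ hp hp, covariance_eq_sub
      (hR.hasGaussianLaw_eval _).memLp_two (hR.hasGaussianLaw_eval _).memLp_two,
      h.integral_residual, h.integral_residual]
    simp
  rw [Finset.sum_congr rfl this, ← Finset.sum_mul, sum_residualCorr_diag hN,
    inv_mul_cancel_left₀ (dof_pos hN).ne']

theorem IsFunctionalSamples.memLp_pooledCov [IsProbabilityMeasure P]
    (h : IsFunctionalSamples P η γ v y) (hG : ∀ i j, IsGaussianProcess (v i j) P)
    {N : Fin k → ℕ} (hN : ∀ i, 2 ≤ N i) (s t : Time a b) :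
    MemLp (fun ω => pooledCov N (curves y ω) s t) 2 P := by
  simp only [pooledCov_eq_sum_residual hN h.model]
  exact (memLp_finsetSum _ fun p _ => memLp_mul_of_isGaussianProcess
    (h.isGaussianProcess_residual hG N) (p, s) (p, t)).const_mul _

/-- By Isserlis, residuals `r` and `r'` contribute `residualCorr N r r' ^ 2` times the plug-in
kernel of `γ₀`. These squares sum to `dof N`, which cancels one of the two factors `(dof N)⁻¹`. -/
theorem IsFunctionalSamples.covariance_pooledCov [NeZero k] [IsProbabilityMeasure P]
    (h : IsFunctionalSamples P η γ v y) (hG : ∀ i j, IsGaussianProcess (v i j) P)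
    (hγ : ∀ i s t, γ i s t = γ₀ s t) {N : Fin k → ℕ} (hN : ∀ i, 2 ≤ N i)
    (p q : Time a b × Time a b) :
    cov[fun ω => pooledCov N (curves y ω) p.1 p.2, fun ω => pooledCov N (curves y ω) q.1 q.2; P] =
      (dof N)⁻¹ * plugIn γ₀ p q := by
  have hR := h.isGaussianProcess_residual hG N
  have hsymm : γ₀ p.2 q.1 = γ₀ q.1 p.2 := by
    rw [← hγ 0, ← hγ 0, ← h.covariance_eq 0 0, ← h.covariance_eq 0 0, covariance_comm]
  simp only [pooledCov_eq_sum_residual hN h.model]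
  rw [covariance_const_mul_left, covariance_const_mul_right, covariance_fun_sum_fun_sum'
    (fun r _ => memLp_mul_of_isGaussianProcess hR _ _)
    (fun r _ => memLp_mul_of_isGaussianProcess hR _ _)]
  have : ∀ r ∈ groupIndices N, ∀ r' ∈ groupIndices N,
      cov[fun ω => residual N v (r, p.1) ω * residual N v (r, p.2) ω,
        fun ω => residual N v (r', q.1) ω * residual N v (r', q.2) ω; P] =
      residualCorr N r r' ^ 2 * plugIn γ₀ p q := by
    intro r hr r' hr'
    rw [covariance_mul_mul_of_isGaussianProcess hR (h.integral_residual N),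
      h.covariance_residual hγ hr hr', h.covariance_residual hγ hr hr',
      h.covariance_residual hγ hr hr', h.covariance_residual hγ hr hr', plugIn, hsymm]
    ring
  rw [Finset.sum_congr rfl fun r hr => Finset.sum_congr rfl fun r' hr' => this r hr r' hr']
  simp only [← Finset.sum_mul]
  rw [sum_residualCorr_sq hN, inv_mul_cancel_left₀ (dof_pos hN).ne']

theorem IsFunctionalSamples.pooledCovKernel_eq [NeZero k] [IsProbabilityMeasure P]
    (h : IsFunctionalSamples P η γ v y) (hG : ∀ i j, IsGaussianProcess (v i j) P)
    (hγ : ∀ i s t, γ i s t = γ₀ s t) {N : Fin k → ℕ} (hN : ∀ i, 2 ≤ N i)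
    (p q : Time a b × Time a b) : pooledCovKernel P N γ₀ y p q = plugIn γ₀ p q := by
  have hi : ∀ s t, Integrable (fun ω => pooledCov N (curves y ω) s t) P :=
    fun s t => (h.memLp_pooledCov hG hN s t).integrable (by simp)
  have hd := dof_pos hN
  rw [pooledCovKernel, covariance_const_mul_left, covariance_const_mul_right,
    covariance_sub_const_left (hi _ _), covariance_sub_const_right (hi _ _),
    h.covariance_pooledCov hG hγ hN, ← mul_assoc, Real.mul_self_sqrt hd.le,
    mul_inv_cancel_left₀ hd.ne']

theorem IsFunctionalSamples.integral_sq_pooledCov_sub [NeZero k] [IsProbabilityMeasure P]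
    (h : IsFunctionalSamples P η γ v y) (hG : ∀ i j, IsGaussianProcess (v i j) P)
    (hγ : ∀ i s t, γ i s t = γ₀ s t) {N : Fin k → ℕ} (hN : ∀ i, 2 ≤ N i) (s t : Time a b) :
    ∫ ω, (pooledCov N (curves y ω) s t - γ₀ s t) ^ 2 ∂P =
      (dof N)⁻¹ * plugIn γ₀ (s, t) (s, t) := by
  rw [← h.covariance_pooledCov hG hγ hN, covariance]
  simp only [h.integral_pooledCov hG hγ hN, sq]

end Model

end ECF

/-! ### Square integrable kernels and their traces -/

namespace ECF

section Kernels

variable {T : Type*} [MeasurableSpace T] {μ : Measure T}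

/-- Nonpositive discriminant of the quadratic `c ↦ ∫ (f + c g)²`. -/
theorem sq_integral_mul_le {f g : T → ℝ} (hf : MemLp f 2 μ) (hg : MemLp g 2 μ) :
    (∫ x, f x * g x ∂μ) ^ 2 ≤ (∫ x, f x ^ 2 ∂μ) * ∫ x, g x ^ 2 ∂μ := by
  have hff := hf.integrable_sq
  have hgg := hg.integrable_sq
  have hfg : Integrable (fun x => f x * g x) μ := hf.integrable_mul hg
  have key : ∀ c : ℝ, 0 ≤ (∫ x, g x ^ 2 ∂μ) * (c * c) + (2 * ∫ x, f x * g x ∂μ) * c +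
      ∫ x, f x ^ 2 ∂μ := by
    intro c
    have h0 : 0 ≤ ∫ x, (f x + c * g x) ^ 2 ∂μ := integral_nonneg fun x => sq_nonneg _
    have e : ∀ x, (f x + c * g x) ^ 2 = c * c * g x ^ 2 + 2 * c * (f x * g x) + f x ^ 2 :=
      fun x => by ring
    simp only [e] at h0
    rw [integral_add (by fun_prop) hff, integral_add (by fun_prop) (by fun_prop),
      integral_const_mul, integral_const_mul] at h0
    linarith
  have := discrim_le_zero key
  rw [discrim] at this
  linarith

variable [SigmaFinite μ]

theorem measurePreserving_prodProdProdComm :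
    MeasurePreserving (fun r : (T × T) × (T × T) => ((r.1.1, r.2.1), (r.1.2, r.2.2)))
      ((μ.prod μ).prod (μ.prod μ)) ((μ.prod μ).prod (μ.prod μ)) := by
  have h1 : MeasurePreserving (MeasurableEquiv.prodAssoc (α := T) (β := T) (γ := T × T))
      ((μ.prod μ).prod (μ.prod μ)) (μ.prod (μ.prod (μ.prod μ))) := measurePreserving_prodAssoc _ _ _
  have h2 : MeasurePreserving (MeasurableEquiv.prodAssoc (α := T) (β := T) (γ := T))
      ((μ.prod μ).prod μ) (μ.prod (μ.prod μ)) := measurePreserving_prodAssoc _ _ _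
  have hid : MeasurePreserving (id : T → T) μ μ := MeasurePreserving.id _
  have hsw : MeasurePreserving (Prod.swap : T × T → T × T) (μ.prod μ) (μ.prod μ) :=
    Measure.measurePreserving_swap
  exact (h1.symm _).comp ((hid.prod h2).comp ((hid.prod (hsw.prod hid)).comp
    ((hid.prod (h2.symm _)).comp h1)))

/-- Makes independent pairs out of `(x, w)` and `(z, y)`, the arguments of opposite edges of the
four-cycle. -/
theorem measurePreserving_crossPairs :
    MeasurePreserving (fun r : (T × T) × (T × T) => ((r.1.1, r.2.2), (r.2.1, r.1.2)))
      ((μ.prod μ).prod (μ.prod μ)) ((μ.prod μ).prod (μ.prod μ)) := by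
  have hid : MeasurePreserving (id : T × T → T × T) (μ.prod μ) (μ.prod μ) := MeasurePreserving.id _
  have hsw : MeasurePreserving (Prod.swap : T × T → T × T) (μ.prod μ) (μ.prod μ) :=
    Measure.measurePreserving_swap
  exact (hid.prod hsw).comp (measurePreserving_prodProdProdComm.comp (hid.prod hsw))

theorem integral_iterated_four {F : (T × T) × (T × T) → ℝ}
    (hF : Integrable F ((μ.prod μ).prod (μ.prod μ))) :
    ∫ x, ∫ y, ∫ z, ∫ w, F ((x, y), (z, w)) ∂μ ∂μ ∂μ ∂μ =
      ∫ r, F r ∂((μ.prod μ).prod (μ.prod μ)) := by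
  rw [integral_prod _ hF, integral_prod _ hF.integral_prod_left]
  refine integral_congr_ae ?_
  filter_upwards [Measure.ae_ae_of_ae_prod hF.prod_right_ae] with x hx
  refine integral_congr_ae ?_
  filter_upwards [hx] with y hy
  rw [integral_prod _ hy]

/-- The four-cycle `a(x,w) b(w,z) c(z,y) d(y,x)` of kernels. -/
def fourCycle (a b c d : T → T → ℝ) (r : (T × T) × (T × T)) : ℝ :=
  a r.1.1 r.2.2 * b r.2.2 r.2.1 * c r.2.1 r.1.2 * d r.1.2 r.1.1

variable {a b c d : T → T → ℝ}

theorem memLp_tensor {μ : Measure T} [SFinite μ]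
    (ha : MemLp (fun p : T × T => a p.1 p.2) 2 (μ.prod μ))
    (hc : MemLp (fun p : T × T => c p.1 p.2) 2 (μ.prod μ)) :
    MemLp (fun r : (T × T) × (T × T) => a r.1.1 r.1.2 * c r.2.1 r.2.2) 2
      ((μ.prod μ).prod (μ.prod μ)) := by
  have hm : AEStronglyMeasurable (fun r : (T × T) × (T × T) => a r.1.1 r.1.2 * c r.2.1 r.2.2)
      ((μ.prod μ).prod (μ.prod μ)) := by
    have h1 := ha.aestronglyMeasurable.comp_fst (ν := μ.prod μ)
    have h2 := hc.aestronglyMeasurable.comp_snd (μ := μ.prod μ)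
    exact h1.mul h2
  rw [memLp_two_iff_integrable_sq hm]
  simp only [mul_pow]
  exact ha.integrable_sq.mul_prod hc.integrable_sq

theorem integral_sq_tensor (a c : T → T → ℝ) :
    ∫ r : (T × T) × (T × T), (a r.1.1 r.1.2 * c r.2.1 r.2.2) ^ 2 ∂((μ.prod μ).prod (μ.prod μ)) =
      (∫ p : T × T, a p.1 p.2 ^ 2 ∂(μ.prod μ)) * ∫ p : T × T, c p.1 p.2 ^ 2 ∂(μ.prod μ) := by
  simp only [mul_pow]
  exact integral_prod_mul (fun p : T × T => a p.1 p.2 ^ 2) (fun p : T × T => c p.1 p.2 ^ 2)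

theorem integral_comp_measurePreserving {α β : Type*} [MeasurableSpace α] [MeasurableSpace β]
    {ν : Measure α} {ρ : Measure β} {φ : α → β} (h : MeasurePreserving φ ν ρ) {f : β → ℝ}
    (hf : AEStronglyMeasurable f ρ) : ∫ x, f (φ x) ∂ν = ∫ y, f y ∂ρ := by
  rw [← h.map_eq]
  exact (integral_map h.aemeasurable (by rwa [h.map_eq])).symm

/-- Opposite edges share no vertex, so `a(x,w) c(z,y)` and `d(y,x) b(w,z)` are permuted tensor
products, each in `L²`. One application of Cauchy–Schwarz to their product suffices. -/
theorem fourCycle_integrable_and_sq_integral_le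
    (ha : MemLp (fun p : T × T => a p.1 p.2) 2 (μ.prod μ))
    (hb : MemLp (fun p : T × T => b p.1 p.2) 2 (μ.prod μ))
    (hc : MemLp (fun p : T × T => c p.1 p.2) 2 (μ.prod μ))
    (hd : MemLp (fun p : T × T => d p.1 p.2) 2 (μ.prod μ)) :
    Integrable (fourCycle a b c d) ((μ.prod μ).prod (μ.prod μ)) ∧
      (∫ r, fourCycle a b c d r ∂((μ.prod μ).prod (μ.prod μ))) ^ 2 ≤
        (∫ p : T × T, a p.1 p.2 ^ 2 ∂(μ.prod μ)) * (∫ p : T × T, b p.1 p.2 ^ 2 ∂(μ.prod μ)) *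
        (∫ p : T × T, c p.1 p.2 ^ 2 ∂(μ.prod μ)) * ∫ p : T × T, d p.1 p.2 ^ 2 ∂(μ.prod μ) := by
  have hsw : MeasurePreserving (Prod.swap : T × T → T × T) (μ.prod μ) (μ.prod μ) :=
    Measure.measurePreserving_swap
  have h1 := (memLp_tensor ha hc).comp_measurePreserving measurePreserving_crossPairs
  have h2 := (memLp_tensor hd hb).comp_measurePreserving (hsw.prod hsw)
  have e : fourCycle a b c d = fun r =>
      ((fun r : (T × T) × (T × T) => a r.1.1 r.1.2 * c r.2.1 r.2.2) ∘
        fun r : (T × T) × (T × T) => ((r.1.1, r.2.2), (r.2.1, r.1.2))) r *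
      ((fun r : (T × T) × (T × T) => d r.1.1 r.1.2 * b r.2.1 r.2.2) ∘
        Prod.map Prod.swap Prod.swap) r := by
    funext r
    simp only [fourCycle, Function.comp, Prod.map, Prod.swap]
    ring
  refine ⟨e ▸ h1.integrable_mul h2, ?_⟩
  rw [e]
  refine (sq_integral_mul_le h1 h2).trans (le_of_eq ?_)
  simp only [Function.comp]
  rw [integral_comp_measurePreserving measurePreserving_crossPairs
      (f := fun r : (T × T) × (T × T) => (a r.1.1 r.1.2 * c r.2.1 r.2.2) ^ 2)
      (memLp_tensor ha hc).integrable_sq.aestronglyMeasurable,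
    integral_comp_measurePreserving (hsw.prod hsw)
      (f := fun r : (T × T) × (T × T) => (d r.1.1 r.1.2 * b r.2.1 r.2.2) ^ 2)
      (memLp_tensor hd hb).integrable_sq.aestronglyMeasurable, integral_sq_tensor,
    integral_sq_tensor]
  ring

/-- With two opposite vertices `x`, `z` fixed, the integral over the other two is the square of `∫
a(x,y) a(y,z) dy`. -/
theorem integral_fourCycle_nonneg (ha : MemLp (fun p : T × T => a p.1 p.2) 2 (μ.prod μ))
    (hs : ∀ s t, a s t = a t s) :
    0 ≤ ∫ r, fourCycle a a a a r ∂((μ.prod μ).prod (μ.prod μ)) := by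
  have hi := (fourCycle_integrable_and_sq_integral_le ha ha ha ha).1
  have hi' : Integrable (fun r : (T × T) × (T × T) =>
      fourCycle a a a a ((r.1.1, r.2.1), (r.1.2, r.2.2))) ((μ.prod μ).prod (μ.prod μ)) :=
    measurePreserving_prodProdProdComm.integrable_comp_of_integrable hi
  rw [← integral_comp_measurePreserving measurePreserving_prodProdProdComm hi.aestronglyMeasurable,
    integral_prod _ hi']
  refine integral_nonneg fun p => ?_
  have e : ∀ q : T × T, fourCycle a a a a ((p.1, q.1), (p.2, q.2)) =
      (a p.1 q.1 * a q.1 p.2) * (a p.1 q.2 * a q.2 p.2) := by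
    intro q
    simp only [fourCycle]
    rw [hs p.2 q.1, hs q.1 p.1]
    ring
  simp only [e]
  rw [integral_prod_mul (fun y => a p.1 y * a y p.2) (fun y => a p.1 y * a y p.2)]
  exact mul_self_nonneg _

end Kernels

/-! ### Trace identities and perturbation bounds -/

section Traces

variable {a b : ℝ} {g f : Time a b → Time a b → ℝ}

instance : IsFiniteMeasure (volume : Measure (Time a b)) :=
  ⟨by rw [Measure.Subtype.volume_univ measurableSet_Icc.nullMeasurableSet]; simp⟩

/-- Square integrability of a kernel. -/
def SqIntegrable (g : Time a b → Time a b → ℝ) : Prop :=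
  MemLp (fun p : Time a b × Time a b => g p.1 p.2) 2 (volume.prod volume)

theorem SqIntegrable.trTwo_eq (hg : SqIntegrable g) :
    trTwo g = ∫ p : Time a b × Time a b, g p.1 p.2 ^ 2 ∂(volume.prod volume) :=
  (integral_prod _ (MemLp.integrable_sq hg)).symm

theorem trTwo_nonneg (g : Time a b → Time a b → ℝ) : 0 ≤ trTwo g :=
  integral_nonneg fun _ => integral_nonneg fun _ => sq_nonneg _

theorem SqIntegrable.trFour_eq (hg : SqIntegrable g) :
    trFour g = ∫ r, fourCycle g g g g r
      ∂((volume.prod volume).prod (volume.prod volume)) :=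
  integral_iterated_four (fourCycle_integrable_and_sq_integral_le hg hg hg hg).1

theorem SqIntegrable.trFour_nonneg (hg : SqIntegrable g) (hs : ∀ s t, g s t = g t s) :
    0 ≤ trFour g := by
  rw [hg.trFour_eq]
  exact integral_fourCycle_nonneg hg hs

/-- Integrability on the diagonal is a separate condition, the diagonal being null in the square. -/
theorem SqIntegrable.trK_plugIn (hg : SqIntegrable g) (hd : Integrable fun t => g t t) :
    trK (plugIn g) = tr g ^ 2 + trTwo g := by
  have hi := MemLp.integrable_sq hg
  simp only [trK, plugIn, ← sq]
  have : ∀ᵐ s : Time a b, ∫ t, (g s s * g t t + g s t ^ 2) = g s s * tr g + ∫ t, g s t ^ 2 := by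
    filter_upwards [hi.prod_right_ae] with s hs
    rw [integral_add (hd.const_mul _) hs, integral_const_mul, tr]
  rw [integral_congr_ae this, integral_add (hd.mul_const _) hi.integral_prod_left,
    integral_mul_const, trTwo, tr, sq]

/-- Squaring the kernel gives two squared tensors, each integrating to `trTwo g ^ 2`, and a cross
term that symmetry turns into a four-cycle. -/
theorem SqIntegrable.trTwoK_plugIn (hg : SqIntegrable g) (hs : ∀ s t, g s t = g t s) :
    trTwoK (plugIn g) = 2 * trTwo g ^ 2 + 2 * trFour g := by
  have hi := (fourCycle_integrable_and_sq_integral_le hg hg hg hg).1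
  have ht := (memLp_tensor hg hg).integrable_sq
  have i1 : Integrable (fun r : (Time a b × Time a b) × (Time a b × Time a b) =>
      (g r.1.1 r.2.1 * g r.1.2 r.2.2) ^ 2) ((volume.prod volume).prod (volume.prod volume)) :=
    measurePreserving_prodProdProdComm.integrable_comp_of_integrable ht
  have i2 : Integrable (fun r : (Time a b × Time a b) × (Time a b × Time a b) =>
      (g r.1.1 r.2.2 * g r.2.1 r.1.2) ^ 2) ((volume.prod volume).prod (volume.prod volume)) :=
    measurePreserving_crossPairs.integrable_comp_of_integrable ht
  have i3 : Integrable (fun r : (Time a b × Time a b) × (Time a b × Time a b) =>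
      fourCycle g g g g ((r.1.1, r.2.1), (r.1.2, r.2.2)))
      ((volume.prod volume).prod (volume.prod volume)) :=
    measurePreserving_prodProdProdComm.integrable_comp_of_integrable hi
  have e : (fun r : (Time a b × Time a b) × (Time a b × Time a b) => plugIn g r.1 r.2 ^ 2) =
      fun r => (g r.1.1 r.2.1 * g r.1.2 r.2.2) ^ 2 + (g r.1.1 r.2.2 * g r.2.1 r.1.2) ^ 2 +
        2 * fourCycle g g g g ((r.1.1, r.2.1), (r.1.2, r.2.2)) := by
    funext r
    simp only [plugIn, fourCycle]
    rw [hs r.2.2 r.1.2, hs r.2.1 r.1.1, hs r.1.2 r.2.1]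
    ring
  have hint : Integrable (fun r : (Time a b × Time a b) × (Time a b × Time a b) =>
      plugIn g r.1 r.2 ^ 2) ((volume.prod volume).prod (volume.prod volume)) := by
    rw [e]
    exact (i1.add i2).add (i3.const_mul 2)
  have h0 : trTwoK (plugIn g) =
      ∫ r : (Time a b × Time a b) × (Time a b × Time a b), plugIn g r.1 r.2 ^ 2
        ∂((volume.prod volume).prod (volume.prod volume)) :=
    integral_iterated_four hint
  rw [h0, e]
  rw [integral_add (by fun_prop) (by fun_prop), integral_add i1 i2, integral_const_mul,
    integral_comp_measurePreserving measurePreserving_prodProdProdComm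
      (f := fun r : (Time a b × Time a b) × (Time a b × Time a b) =>
        (g r.1.1 r.1.2 * g r.2.1 r.2.2) ^ 2) ht.aestronglyMeasurable,
    integral_comp_measurePreserving measurePreserving_crossPairs
      (f := fun r : (Time a b × Time a b) × (Time a b × Time a b) =>
        (g r.1.1 r.1.2 * g r.2.1 r.2.2) ^ 2) ht.aestronglyMeasurable,
    integral_comp_measurePreserving measurePreserving_prodProdProdComm hi.aestronglyMeasurable,
    integral_sq_tensor, ← hg.trTwo_eq, ← hg.trFour_eq]
  ring

theorem SqIntegrable.abs_trTwo_sub_le (hg : SqIntegrable g) (hf : SqIntegrable f) :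
    |trTwo g - trTwo f| ≤
      trTwo (fun s t => g s t - f s t) + 2 * √(trTwo f * trTwo (fun s t => g s t - f s t)) := by
  have hh : SqIntegrable fun s t => g s t - f s t := MemLp.sub hg hf
  have hfh : Integrable (fun p : Time a b × Time a b => f p.1 p.2 * (g p.1 p.2 - f p.1 p.2))
      (volume.prod volume) := MemLp.integrable_mul hf hh
  have e : trTwo g - trTwo f = trTwo (fun s t => g s t - f s t) +
      2 * ∫ p : Time a b × Time a b, f p.1 p.2 * (g p.1 p.2 - f p.1 p.2)
        ∂(volume.prod volume) := by
    rw [hg.trTwo_eq, hf.trTwo_eq, hh.trTwo_eq, ← integral_const_mul,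
      ← integral_sub (MemLp.integrable_sq hg) (MemLp.integrable_sq hf),
      ← integral_add (MemLp.integrable_sq hh) (hfh.const_mul 2)]
    refine integral_congr_ae (ae_of_all _ fun p => ?_)
    ring
  have hcs := Real.abs_le_sqrt (sq_integral_mul_le hf hh)
  rw [← hf.trTwo_eq, ← hh.trTwo_eq] at hcs
  rw [e]
  refine (abs_add_le _ _).trans ?_
  rw [abs_of_nonneg (trTwo_nonneg _), abs_mul, abs_two]
  linarith

theorem SqIntegrable.abs_integral_fourCycle_le {g₁ g₂ g₃ g₄ : Time a b → Time a b → ℝ}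
    (h₁ : SqIntegrable g₁) (h₂ : SqIntegrable g₂) (h₃ : SqIntegrable g₃) (h₄ : SqIntegrable g₄) :
    |∫ r, fourCycle g₁ g₂ g₃ g₄ r ∂((volume.prod volume).prod (volume.prod volume))| ≤
      √(trTwo g₁ * trTwo g₂ * trTwo g₃ * trTwo g₄) := by
  refine Real.abs_le_sqrt ?_
  rw [h₁.trTwo_eq, h₂.trTwo_eq, h₃.trTwo_eq, h₄.trTwo_eq]
  exact (fourCycle_integrable_and_sq_integral_le h₁ h₂ h₃ h₄).2

/-- Replacing `g` by `f` one edge at a time telescopes the difference into four cycles, each with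
one edge `g - f`. -/
theorem SqIntegrable.abs_trFour_sub_le (hg : SqIntegrable g) (hf : SqIntegrable f) :
    |trFour g - trFour f| ≤
      √(trTwo (fun s t => g s t - f s t) * trTwo g * trTwo g * trTwo g) +
      √(trTwo f * trTwo (fun s t => g s t - f s t) * trTwo g * trTwo g) +
      √(trTwo f * trTwo f * trTwo (fun s t => g s t - f s t) * trTwo g) +
      √(trTwo f * trTwo f * trTwo f * trTwo (fun s t => g s t - f s t)) := by
  have hh : SqIntegrable fun s t => g s t - f s t := MemLp.sub hg hf
  have i1 := (fourCycle_integrable_and_sq_integral_le (a := fun s t => g s t - f s t) hh hg hg hg).1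
  have i2 := (fourCycle_integrable_and_sq_integral_le (b := fun s t => g s t - f s t) hf hh hg hg).1
  have i3 := (fourCycle_integrable_and_sq_integral_le (c := fun s t => g s t - f s t) hf hf hh hg).1
  have i4 := (fourCycle_integrable_and_sq_integral_le (d := fun s t => g s t - f s t) hf hf hf hh).1
  have e : trFour g - trFour f =
      (∫ r, fourCycle (fun s t => g s t - f s t) g g g r
        ∂((volume.prod volume).prod (volume.prod volume))) +
      (∫ r, fourCycle f (fun s t => g s t - f s t) g g r
        ∂((volume.prod volume).prod (volume.prod volume))) +
      (∫ r, fourCycle f f (fun s t => g s t - f s t) g r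
        ∂((volume.prod volume).prod (volume.prod volume))) +
      (∫ r, fourCycle f f f (fun s t => g s t - f s t) r
        ∂((volume.prod volume).prod (volume.prod volume))) := by
    rw [hg.trFour_eq, hf.trFour_eq, ← integral_add i1 i2, ← integral_add (by fun_prop) i3,
      ← integral_add (by fun_prop) i4,
      ← integral_sub (fourCycle_integrable_and_sq_integral_le hg hg hg hg).1
        (fourCycle_integrable_and_sq_integral_le hf hf hf hf).1]
    refine integral_congr_ae (ae_of_all _ fun r => ?_)
    simp only [fourCycle]
    ring
  rw [e]
  have b1 := hh.abs_integral_fourCycle_le hg hg hg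
  have b2 := hf.abs_integral_fourCycle_le hh hg hg
  have b3 := hf.abs_integral_fourCycle_le hf hh hg
  have b4 := hf.abs_integral_fourCycle_le hf hf hh
  exact (abs_add_le _ _).trans (add_le_add ((abs_add_le _ _).trans (add_le_add
    ((abs_add_le _ _).trans (add_le_add b1 b2)) b3)) b4)

end Traces

/-! ### Continuity of the traces under `L²` convergence of kernels -/

section Limits

variable {a b : ℝ} {ι : Type*} {l : Filter ι} {g : ι → Time a b → Time a b → ℝ}
  {f : Time a b → Time a b → ℝ}

theorem tendsto_trTwo (hf : SqIntegrable f) (hg : ∀ᶠ x in l, SqIntegrable (g x))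
    (h : Tendsto (fun x => trTwo fun s t => g x s t - f s t) l (𝓝 0)) :
    Tendsto (fun x => trTwo (g x)) l (𝓝 (trTwo f)) := by
  rw [tendsto_iff_norm_sub_tendsto_zero]
  have hb : Tendsto (fun x => trTwo (fun s t => g x s t - f s t) +
      2 * √(trTwo f * trTwo (fun s t => g x s t - f s t))) l (𝓝 0) := by
    have := h.add (((h.const_mul (trTwo f)).sqrt).const_mul 2)
    simpa using this
  refine tendsto_of_tendsto_of_tendsto_of_le_of_le' tendsto_const_nhds hb
    (Eventually.of_forall fun _ => norm_nonneg _) ?_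
  filter_upwards [hg] with x hx
  exact hx.abs_trTwo_sub_le hf

theorem tendsto_trFour (hf : SqIntegrable f) (hg : ∀ᶠ x in l, SqIntegrable (g x))
    (h : Tendsto (fun x => trTwo fun s t => g x s t - f s t) l (𝓝 0)) :
    Tendsto (fun x => trFour (g x)) l (𝓝 (trFour f)) := by
  rw [tendsto_iff_norm_sub_tendsto_zero]
  have h2 := tendsto_trTwo hf hg h
  have hf' : Tendsto (fun _ : ι => trTwo f) l (𝓝 (trTwo f)) := tendsto_const_nhds
  have hb := (((((h.mul h2).mul h2).mul h2).sqrt.add (((hf'.mul h).mul h2).mul h2).sqrt).add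
    (((hf'.mul hf').mul h).mul h2).sqrt).add (((hf'.mul hf').mul hf').mul h).sqrt
  simp only [zero_mul, mul_zero, Real.sqrt_zero, add_zero] at hb
  refine tendsto_of_tendsto_of_tendsto_of_le_of_le' tendsto_const_nhds hb
    (Eventually.of_forall fun _ => norm_nonneg _) ?_
  filter_upwards [hg] with x hx
  exact hx.abs_trFour_sub_le hf

end Limits

end ECF

/-! ### The common covariance function -/

namespace ECF

variable {a b : ℝ} {k : ℕ} {Ω : Type*} [MeasurableSpace Ω] {P : Measure Ω}
  {η : Fin k → Time a b → ℝ} {γ : Fin k → Time a b → Time a b → ℝ}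
  {v y : Fin k → ℕ → Time a b → Ω → ℝ} {γ₀ : Time a b → Time a b → ℝ}

theorem IsFunctionalSamples.eq_integral_mul [IsProbabilityMeasure P]
    (h : IsFunctionalSamples P η γ v y) (hγ : ∀ i s t, γ i s t = γ₀ s t) (i : Fin k)
    (s t : Time a b) : γ₀ s t = ∫ ω, v i 0 s ω * v i 0 t ω ∂P := by
  rw [← hγ i, ← h.covariance_eq i 0, covariance_eq_sub (h.memLp _ _ _) (h.memLp _ _ _),
    h.centered, h.centered]
  simp

theorem IsFunctionalSamples.symm [NeZero k] (h : IsFunctionalSamples P η γ v y)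
    (hγ : ∀ i s t, γ i s t = γ₀ s t) (s t : Time a b) : γ₀ s t = γ₀ t s := by
  rw [← hγ 0, ← hγ 0, ← h.covariance_eq 0 0, ← h.covariance_eq 0 0, covariance_comm]

/-- Joint measurability of the process passes to `E[v(s) v(t)]` by integrating out `ω`. -/
theorem IsFunctionalSamples.measurable_cov [NeZero k] [IsProbabilityMeasure P]
    (h : IsFunctionalSamples P η γ v y) (hγ : ∀ i s t, γ i s t = γ₀ s t) :
    Measurable fun p : Time a b × Time a b => γ₀ p.1 p.2 := by
  simp only [h.eq_integral_mul hγ 0]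
  have hv := h.measurable 0 0
  have hm : Measurable fun r : (Time a b × Time a b) × Ω => v 0 0 r.1.1 r.2 * v 0 0 r.1.2 r.2 :=
    (hv.comp (by fun_prop : Measurable fun r : (Time a b × Time a b) × Ω => (r.1.1, r.2))).mul
      (hv.comp (by fun_prop : Measurable fun r : (Time a b × Time a b) × Ω => (r.1.2, r.2)))
  exact (hm.stronglyMeasurable.integral_prod_right' (ν := P)).measurable

theorem measurable_plugIn (hm : Measurable fun p : Time a b × Time a b => γ₀ p.1 p.2) :
    Measurable fun p : Time a b × Time a b => plugIn γ₀ p p := by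
  unfold plugIn
  exact ((hm.comp (by fun_prop : Measurable fun p : Time a b × Time a b => (p.1, p.1))).mul
    (hm.comp (by fun_prop : Measurable fun p : Time a b × Time a b => (p.2, p.2)))).add (hm.mul hm)

theorem abs_plugIn_le {C : ℝ} (hC : ∀ s t, |γ₀ s t| ≤ C) (p q : Time a b × Time a b) :
    |plugIn γ₀ p q| ≤ C * C + C * C := by
  have hC0 : 0 ≤ C := (abs_nonneg _).trans (hC p.1 p.1)
  refine (abs_add_le _ _).trans ?_
  rw [abs_mul, abs_mul]
  exact add_le_add (mul_le_mul (hC _ _) (hC _ _) (abs_nonneg _) hC0)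
    (mul_le_mul (hC _ _) (hC _ _) (abs_nonneg _) hC0)

theorem sqIntegrable_of_bound (hm : Measurable fun p : Time a b × Time a b => γ₀ p.1 p.2)
    {C : ℝ} (hC : ∀ s t, |γ₀ s t| ≤ C) : SqIntegrable γ₀ :=
  MemLp.of_bound hm.aestronglyMeasurable C (ae_of_all _ fun p => hC p.1 p.2)

theorem integrable_diag_of_bound (hm : Measurable fun p : Time a b × Time a b => γ₀ p.1 p.2)
    {C : ℝ} (hC : ∀ s t, |γ₀ s t| ≤ C) : Integrable fun t => γ₀ t t :=
  Integrable.of_bound (hm.comp (by fun_prop :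
    Measurable fun t : Time a b => (t, t))).aestronglyMeasurable C (ae_of_all _ fun t => hC t t)

theorem IsFunctionalSamples.integrable_sq_path [IsProbabilityMeasure P]
    (h : IsFunctionalSamples P η γ v y) (hγ : ∀ i s t, γ i s t = γ₀ s t) (i : Fin k) :
    Integrable (fun r : Time a b × Ω => v i 0 r.1 r.2 ^ 2) (volume.prod P) := by
  rw [integrable_prod_iff ((h.measurable i 0).pow_const 2).aestronglyMeasurable]
  refine ⟨ae_of_all _ fun t => (h.memLp i 0 t).integrable_sq, ?_⟩
  refine (h.trace_finite i).congr (ae_of_all _ fun t => ?_)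
  simp only [norm_pow, Real.norm_eq_abs, sq_abs]
  rw [hγ, h.eq_integral_mul hγ i]
  simp only [sq]

/-- A path of a process whose covariance kernel vanishes almost everywhere is almost surely
orthogonal to every square integrable function. -/
theorem IsFunctionalSamples.ae_integral_mul_eq_zero [IsProbabilityMeasure P]
    (h : IsFunctionalSamples P η γ v y) (hγ : ∀ i s t, γ i s t = γ₀ s t) (i : Fin k)
    {C : ℝ} (hC : ∀ s t, |γ₀ s t| ≤ C)
    (h0 : ∀ᵐ p : Time a b × Time a b ∂(volume.prod volume), γ₀ p.1 p.2 = 0)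
    {φ : Time a b → ℝ} (hφ : MemLp φ 2 volume) :
    ∀ᵐ ω ∂P, ∫ t, v i 0 t ω * φ t = 0 := by
  have hv := h.measurable i 0
  have hφ1 : Integrable φ := hφ.integrable (by simp)
  have hφφ : Integrable (fun p : Time a b × Time a b => φ p.1 * φ p.2) (volume.prod volume) :=
    hφ1.mul_prod hφ1
  have hvv : ∀ s t, Integrable (fun ω => v i 0 s ω * v i 0 t ω) P :=
    fun s t => (h.memLp i 0 s).integrable_mul (h.memLp i 0 t)
  -- The bound on the variances controls the absolute product by `|xy| ≤ (x² + y²)/2`; it supplies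
  -- the integrability for Fubini.
  have habs : ∀ s t, ∫ ω, |v i 0 s ω * v i 0 t ω| ∂P ≤ C := by
    intro s t
    have hle : ∫ ω, |v i 0 s ω * v i 0 t ω| ∂P ≤
        ∫ ω, (1 / 2 * (v i 0 s ω * v i 0 s ω) + 1 / 2 * (v i 0 t ω * v i 0 t ω)) ∂P := by
      refine integral_mono (hvv s t).abs (((hvv s s).const_mul _).add ((hvv t t).const_mul _)) ?_
      intro ω
      simp only [abs_mul]
      have := sq_nonneg (|v i 0 s ω| - |v i 0 t ω|)
      have e1 := abs_mul_abs_self (v i 0 s ω)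
      have e2 := abs_mul_abs_self (v i 0 t ω)
      nlinarith
    rw [integral_add ((hvv s s).const_mul _) ((hvv t t).const_mul _), integral_const_mul,
      integral_const_mul, ← h.eq_integral_mul hγ, ← h.eq_integral_mul hγ] at hle
    linarith [le_of_abs_le (hC s s), le_of_abs_le (hC t t)]
  have hvm : Measurable fun r : (Time a b × Time a b) × Ω => v i 0 r.1.1 r.2 * v i 0 r.1.2 r.2 :=
    (hv.comp (by fun_prop : Measurable fun r : (Time a b × Time a b) × Ω => (r.1.1, r.2))).mul
      (hv.comp (by fun_prop : Measurable fun r : (Time a b × Time a b) × Ω => (r.1.2, r.2)))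
  have hF : Integrable (fun r : (Time a b × Time a b) × Ω =>
      (v i 0 r.1.1 r.2 * v i 0 r.1.2 r.2) * (φ r.1.1 * φ r.1.2))
      ((volume.prod volume).prod P) := by
    have hm : AEStronglyMeasurable (fun r : (Time a b × Time a b) × Ω =>
        (v i 0 r.1.1 r.2 * v i 0 r.1.2 r.2) * (φ r.1.1 * φ r.1.2))
        ((volume.prod volume).prod P) :=
      hvm.aestronglyMeasurable.mul (hφφ.aestronglyMeasurable.comp_fst (ν := P))
    rw [integrable_prod_iff hm]
    refine ⟨ae_of_all _ fun p => (hvv p.1 p.2).mul_const (φ p.1 * φ p.2), ?_⟩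
    refine (hφφ.norm.const_mul C).mono' hm.norm.integral_prod_right' (ae_of_all _ fun p => ?_)
    simp only [norm_mul (_ * _) (φ p.1 * φ p.2), integral_mul_const]
    rw [Real.norm_of_nonneg (mul_nonneg (integral_nonneg fun _ => norm_nonneg _) (norm_nonneg _))]
    exact mul_le_mul_of_nonneg_right (habs p.1 p.2) (norm_nonneg _)
  have hsq : ∀ ω, ∫ p : Time a b × Time a b, (v i 0 p.1 ω * v i 0 p.2 ω) * (φ p.1 * φ p.2)
      ∂(volume.prod volume) = (∫ t, v i 0 t ω * φ t) ^ 2 := by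
    intro ω
    rw [sq, ← integral_prod_mul]
    exact integral_congr_ae (ae_of_all _ fun p => by ring)
  -- By Fubini the second moment of `∫ v φ` is `∫∫ γ₀(s,t) φ(s) φ(t) ds dt`.
  have hz : ∫ ω, (∫ t, v i 0 t ω * φ t) ^ 2 ∂P = 0 := by
    simp only [← hsq]
    rw [← integral_integral_swap hF]
    refine integral_eq_zero_of_ae ?_
    filter_upwards [h0] with p hp
    rw [integral_mul_const, ← h.eq_integral_mul hγ, hp, zero_mul, Pi.zero_apply]
  have hI : Integrable (fun ω => (∫ t, v i 0 t ω * φ t) ^ 2) P := by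
    simp only [← hsq]
    exact hF.integral_prod_right
  have := (integral_eq_zero_iff_of_nonneg (fun ω => sq_nonneg _) hI).1 hz
  filter_upwards [this] with ω hω
  simpa using hω

instance : TopologicalSpace.SeparableSpace (Lp ℝ 2 (volume : Measure (Time a b))) := by
  have : Fact ((2 : ENNReal) ≠ ⊤) := ⟨by simp⟩
  infer_instance

theorem ae_eq_zero_of_orthogonal_dense {f : Time a b → ℝ} (hf : MemLp f 2 volume)
    (h : ∀ n, ∫ t, f t * TopologicalSpace.denseSeq (Lp ℝ 2 (volume : Measure (Time a b))) n t = 0) :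
    f =ᵐ[volume] 0 := by
  have h0 : hf.toLp f = 0 := by
    refine (TopologicalSpace.denseRange_denseSeq _).eq_zero_of_inner_left ℝ fun n => ?_
    rw [L2.inner_def, ← h n]
    refine integral_congr_ae ?_
    filter_upwards [hf.coeFn_toLp] with t ht
    rw [ht]
    simp [mul_comm]
  exact hf.coeFn_toLp.symm.trans (h0 ▸ Lp.coeFn_zero _ _ _)

/-- A kernel vanishing almost everywhere on the square may still be nonzero on the diagonal, so the
paths are needed: if `γ₀ = 0` a.e., almost every path is orthogonal to a dense sequence of `L²`,
hence zero a.e., and `tr γ₀ = E ∫ v²` vanishes. -/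
theorem IsFunctionalSamples.trTwo_pos [NeZero k] [IsProbabilityMeasure P]
    (h : IsFunctionalSamples P η γ v y) (hγ : ∀ i s t, γ i s t = γ₀ s t)
    {C : ℝ} (hC : ∀ s t, |γ₀ s t| ≤ C) (hpos : 0 < tr γ₀) : 0 < trTwo γ₀ := by
  have hg := sqIntegrable_of_bound (h.measurable_cov hγ) hC
  refine lt_of_le_of_ne (trTwo_nonneg _) fun h0 => ?_
  rw [hg.trTwo_eq] at h0
  have hz : ∀ᵐ p : Time a b × Time a b ∂(volume.prod volume), γ₀ p.1 p.2 = 0 := by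
    filter_upwards [(integral_eq_zero_iff_of_nonneg (fun p => sq_nonneg _)
      (MemLp.integrable_sq hg)).1 h0.symm] with p hp
    simpa using hp
  have hsq := h.integrable_sq_path hγ 0
  have hv := h.measurable 0 0
  -- The exceptional null set depends on the test function; countably many test functions leave a
  -- single one.
  have horth : ∀ᵐ ω ∂P, ∀ n, ∫ t, v 0 0 t ω *
      TopologicalSpace.denseSeq (Lp ℝ 2 (volume : Measure (Time a b))) n t = 0 :=
    ae_all_iff.2 fun n => h.ae_integral_mul_eq_zero hγ 0 hC hz (Lp.memLp _)
  have hpath : ∀ᵐ ω ∂P, ∫ t, v 0 0 t ω ^ 2 = 0 := by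
    filter_upwards [horth, hsq.prod_left_ae] with ω h1 h2
    have hmem : MemLp (fun t => v 0 0 t ω) 2 volume :=
      (memLp_two_iff_integrable_sq (hv.comp (by fun_prop :
        Measurable fun t : Time a b => (t, ω))).aestronglyMeasurable).2 h2
    refine integral_eq_zero_of_ae ?_
    filter_upwards [ae_eq_zero_of_orthogonal_dense hmem h1] with t ht
    simp [ht]
  have : tr γ₀ = 0 := by
    simp only [tr, h.eq_integral_mul hγ 0, ← sq]
    rw [integral_integral_swap hsq]
    exact integral_eq_zero_of_ae hpath
  linarith

/-! ### Convergence of the traces of the pooled sample covariance function -/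

theorem pooledCov_symm (N : Fin k → ℕ) (x : Fin k → ℕ → Time a b → ℝ) (s t : Time a b) :
    pooledCov N x s t = pooledCov N x t s := by
  simp only [pooledCov, sampleCov, mul_comm (x _ _ s - _)]

theorem IsFunctionalSamples.measurable_pooledCov (h : IsFunctionalSamples P η γ v y)
    {N : Fin k → ℕ} (hN : ∀ i, 2 ≤ N i) {α : Type*} [MeasurableSpace α] {s t : α → Time a b}
    {w : α → Ω} (hs : Measurable s) (ht : Measurable t) (hw : Measurable w) :
    Measurable fun r => pooledCov N (curves y (w r)) (s r) (t r) := by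
  simp only [pooledCov_eq_sum_residual hN h.model]
  have hr : ∀ p (u : α → Time a b), Measurable u →
      Measurable fun r => residual N v (p, u r) (w r) := by
    intro p u hu
    simp only [residual]
    have hv : ∀ i j, Measurable fun r => v i j (u r) (w r) :=
      fun i j => (h.measurable i j).comp (hu.prodMk hw)
    exact (hv _ _).sub ((Finset.measurable_fun_sum _ fun l _ => hv _ l).const_mul _)
  exact (Finset.measurable_fun_sum _ fun p _ => (hr p s hs).mul (hr p t ht)).const_mul _

/-! ### Mean squared error along a map into the square -/

section Error

variable {S : Type*} [MeasurableSpace S] {ν : Measure S} [IsFiniteMeasure ν]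
  {φ : S → Time a b × Time a b}

/-- The map `φ` covers both uses at once: the identity gives the error on the square, `t ↦ (t, t)`
the error on the diagonal. -/
theorem IsFunctionalSamples.integrable_sq_error [NeZero k] [IsProbabilityMeasure P]
    (h : IsFunctionalSamples P η γ v y) (hG : ∀ i j, IsGaussianProcess (v i j) P)
    (hγ : ∀ i s t, γ i s t = γ₀ s t) {C : ℝ} (hC : ∀ s t, |γ₀ s t| ≤ C)
    {N : Fin k → ℕ} (hN : ∀ i, 2 ≤ N i) (hφ : Measurable φ) :
    Integrable (fun r : S × Ω =>
      (pooledCov N (curves y r.2) (φ r.1).1 (φ r.1).2 - γ₀ (φ r.1).1 (φ r.1).2) ^ 2)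
      (ν.prod P) := by
  have hm₁ : Measurable fun r : S × Ω => pooledCov N (curves y r.2) (φ r.1).1 (φ r.1).2 :=
    h.measurable_pooledCov hN (by fun_prop) (by fun_prop) measurable_snd
  have hm₂ : Measurable fun r : S × Ω => γ₀ (φ r.1).1 (φ r.1).2 :=
    (h.measurable_cov hγ).comp (hφ.comp measurable_fst)
  have hm : Measurable fun r : S × Ω =>
      (pooledCov N (curves y r.2) (φ r.1).1 (φ r.1).2 - γ₀ (φ r.1).1 (φ r.1).2) ^ 2 :=
    (hm₁.sub hm₂).pow_const 2
  rw [integrable_prod_iff hm.aestronglyMeasurable]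
  constructor
  · refine ae_of_all _ fun s => ?_
    have hmem : MemLp (fun ω => pooledCov N (curves y ω) (φ s).1 (φ s).2 - γ₀ (φ s).1 (φ s).2) 2 P :=
      (h.memLp_pooledCov hG hN _ _).sub (memLp_const (γ₀ (φ s).1 (φ s).2))
    exact hmem.integrable_sq
  · have hp : Integrable (fun s => plugIn γ₀ (φ s) (φ s)) ν :=
      Integrable.of_bound ((measurable_plugIn (h.measurable_cov hγ)).comp hφ).aestronglyMeasurable
        (C * C + C * C) (ae_of_all _ fun s => abs_plugIn_le hC _ _)
    refine (hp.const_mul (dof N)⁻¹).congr (ae_of_all _ fun s => ?_)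
    dsimp only
    rw [← h.integral_sq_pooledCov_sub hG hγ hN]
    simp only [norm_pow, Real.norm_eq_abs, sq_abs]

theorem IsFunctionalSamples.integral_integral_sq_error [NeZero k] [IsProbabilityMeasure P]
    (h : IsFunctionalSamples P η γ v y) (hG : ∀ i j, IsGaussianProcess (v i j) P)
    (hγ : ∀ i s t, γ i s t = γ₀ s t) {C : ℝ} (hC : ∀ s t, |γ₀ s t| ≤ C)
    {N : Fin k → ℕ} (hN : ∀ i, 2 ≤ N i) (hφ : Measurable φ) :
    ∫ ω, ∫ s, (pooledCov N (curves y ω) (φ s).1 (φ s).2 - γ₀ (φ s).1 (φ s).2) ^ 2 ∂ν ∂P =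
      (dof N)⁻¹ * ∫ s, plugIn γ₀ (φ s) (φ s) ∂ν := by
  rw [← integral_integral_swap (h.integrable_sq_error hG hγ hC hN hφ), ← integral_const_mul]
  simp only [h.integral_sq_pooledCov_sub hG hγ hN]

theorem IsFunctionalSamples.tendsto_integral_sq_error [NeZero k] [IsProbabilityMeasure P]
    (h : IsFunctionalSamples P η γ v y) (hG : ∀ i j, IsGaussianProcess (v i j) P)
    (hγ : ∀ i s t, γ i s t = γ₀ s t) {C : ℝ} (hC : ∀ s t, |γ₀ s t| ≤ C)
    {N : ℕ → Fin k → ℕ} (hN : ∀ᶠ m in atTop, ∀ i, 2 ≤ N m i)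
    (hd : Tendsto (fun m => dof (N m)) atTop atTop) (hφ : Measurable φ) :
    Tendsto (fun x : ℕ × Ω => ∫ s, (pooledCov (N x.1) (curves y x.2) (φ s).1 (φ s).2 -
      γ₀ (φ s).1 (φ s).2) ^ 2 ∂ν) (inProbability P atTop) (𝓝 0) := by
  refine tendsto_inProbability_zero_of_tendsto_integral (X := fun m ω => ∫ s,
    (pooledCov (N m) (curves y ω) (φ s).1 (φ s).2 - γ₀ (φ s).1 (φ s).2) ^ 2 ∂ν)
    (fun m ω => integral_nonneg fun _ => sq_nonneg _) ?_ ?_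
  · filter_upwards [hN] with m hm
    exact (h.integrable_sq_error hG hγ hC hm hφ).integral_prod_right
  · have := (tendsto_inv_atTop_zero.comp hd).mul_const (∫ s, plugIn γ₀ (φ s) (φ s) ∂ν)
    rw [zero_mul] at this
    refine this.congr' ?_
    filter_upwards [hN] with m hm
    exact (h.integral_integral_sq_error hG hγ hC hm hφ).symm

end Error

/-! ### Consistency of the pooled covariance and its trace -/

section Consistency

variable {N : ℕ → Fin k → ℕ} {C : ℝ}

theorem IsFunctionalSamples.eventually_sqIntegrable_pooledCov [NeZero k] [IsProbabilityMeasure P]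
    (h : IsFunctionalSamples P η γ v y) (hG : ∀ i j, IsGaussianProcess (v i j) P)
    (hγ : ∀ i s t, γ i s t = γ₀ s t) (hC : ∀ s t, |γ₀ s t| ≤ C)
    (hN : ∀ᶠ m in atTop, ∀ i, 2 ≤ N m i) :
    ∀ᶠ x : ℕ × Ω in inProbability P atTop, SqIntegrable (pooledCov (N x.1) (curves y x.2)) := by
  refine eventually_inProbability_of_ae ?_
  filter_upwards [hN] with m hm
  have hi := h.integrable_sq_error (ν := volume.prod volume) hG hγ hC hm measurable_id
  have hg := sqIntegrable_of_bound (h.measurable_cov hγ) hC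
  filter_upwards [hi.prod_left_ae] with ω hω
  have hmeas : Measurable fun p : Time a b × Time a b => pooledCov (N m) (curves y ω) p.1 p.2 :=
    h.measurable_pooledCov hm measurable_fst measurable_snd measurable_const
  have hd : SqIntegrable fun s t => pooledCov (N m) (curves y ω) s t - γ₀ s t :=
    (memLp_two_iff_integrable_sq (hmeas.sub (h.measurable_cov hγ)).aestronglyMeasurable).2 hω
  have : SqIntegrable fun s t => (pooledCov (N m) (curves y ω) s t - γ₀ s t) + γ₀ s t :=
    MemLp.add hd hg
  simpa using this

theorem IsFunctionalSamples.eventually_memLp_diag [NeZero k] [IsProbabilityMeasure P]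
    (h : IsFunctionalSamples P η γ v y) (hG : ∀ i j, IsGaussianProcess (v i j) P)
    (hγ : ∀ i s t, γ i s t = γ₀ s t) (hC : ∀ s t, |γ₀ s t| ≤ C)
    (hN : ∀ᶠ m in atTop, ∀ i, 2 ≤ N m i) :
    ∀ᶠ x : ℕ × Ω in inProbability P atTop,
      MemLp (fun t => pooledCov (N x.1) (curves y x.2) t t - γ₀ t t) 2 volume := by
  refine eventually_inProbability_of_ae ?_
  filter_upwards [hN] with m hm
  have hφ : Measurable fun t : Time a b => (t, t) := by fun_prop
  have hi := h.integrable_sq_error (ν := volume) hG hγ hC hm hφ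
  filter_upwards [hi.prod_left_ae] with ω hω
  have hmeas : Measurable fun t => pooledCov (N m) (curves y ω) t t :=
    h.measurable_pooledCov hm measurable_id measurable_id measurable_const
  exact (memLp_two_iff_integrable_sq
    (hmeas.sub ((h.measurable_cov hγ).comp hφ)).aestronglyMeasurable).2 hω

theorem IsFunctionalSamples.tendsto_trTwo_error [NeZero k] [IsProbabilityMeasure P]
    (h : IsFunctionalSamples P η γ v y) (hG : ∀ i j, IsGaussianProcess (v i j) P)
    (hγ : ∀ i s t, γ i s t = γ₀ s t) (hC : ∀ s t, |γ₀ s t| ≤ C)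
    (hN : ∀ᶠ m in atTop, ∀ i, 2 ≤ N m i) (hd : Tendsto (fun m => dof (N m)) atTop atTop) :
    Tendsto (fun x : ℕ × Ω =>
      trTwo fun s t => pooledCov (N x.1) (curves y x.2) s t - γ₀ s t)
      (inProbability P atTop) (𝓝 0) := by
  refine (h.tendsto_integral_sq_error (ν := volume.prod volume) hG hγ hC hN hd
    measurable_id).congr' ?_
  filter_upwards [h.eventually_sqIntegrable_pooledCov hG hγ hC hN] with x hx
  have hg := sqIntegrable_of_bound (h.measurable_cov hγ) hC
  have hh : SqIntegrable fun s t => pooledCov (N x.1) (curves y x.2) s t - γ₀ s t :=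
    MemLp.sub hx hg
  rw [hh.trTwo_eq]
  rfl

theorem IsFunctionalSamples.eventually_integrable_diag [NeZero k] [IsProbabilityMeasure P]
    (h : IsFunctionalSamples P η γ v y) (hG : ∀ i j, IsGaussianProcess (v i j) P)
    (hγ : ∀ i s t, γ i s t = γ₀ s t) (hC : ∀ s t, |γ₀ s t| ≤ C)
    (hN : ∀ᶠ m in atTop, ∀ i, 2 ≤ N m i) :
    ∀ᶠ x : ℕ × Ω in inProbability P atTop,
      Integrable fun t => pooledCov (N x.1) (curves y x.2) t t := by
  filter_upwards [h.eventually_memLp_diag hG hγ hC hN] with x hx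
  have := (hx.integrable (by simp)).add (integrable_diag_of_bound (h.measurable_cov hγ) hC)
  refine this.congr (ae_of_all _ fun t => ?_)
  simp

/-- The trace is not controlled by the `L²` norm on the square, so the diagonal error is used, with
Cauchy–Schwarz against the constant `1` on an interval of finite length. -/
theorem IsFunctionalSamples.tendsto_tr_pooledCov [NeZero k] [IsProbabilityMeasure P]
    (h : IsFunctionalSamples P η γ v y) (hG : ∀ i j, IsGaussianProcess (v i j) P)
    (hγ : ∀ i s t, γ i s t = γ₀ s t) (hC : ∀ s t, |γ₀ s t| ≤ C)
    (hN : ∀ᶠ m in atTop, ∀ i, 2 ≤ N m i) (hd : Tendsto (fun m => dof (N m)) atTop atTop) :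
    Tendsto (fun x : ℕ × Ω => tr (pooledCov (N x.1) (curves y x.2)))
      (inProbability P atTop) (𝓝 (tr γ₀)) := by
  have hφ : Measurable fun t : Time a b => (t, t) := by fun_prop
  rw [tendsto_iff_norm_sub_tendsto_zero]
  have hb := ((h.tendsto_integral_sq_error (ν := volume) hG hγ hC hN hd hφ).mul_const
    (∫ _ : Time a b, (1 : ℝ) ^ 2)).sqrt
  rw [zero_mul, Real.sqrt_zero] at hb
  refine tendsto_of_tendsto_of_tendsto_of_le_of_le' tendsto_const_nhds hb
    (Eventually.of_forall fun _ => norm_nonneg _) ?_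
  filter_upwards [h.eventually_memLp_diag hG hγ hC hN,
    h.eventually_integrable_diag hG hγ hC hN] with x hx hx'
  have hcs := Real.abs_le_sqrt (sq_integral_mul_le hx (memLp_const (1 : ℝ)))
  simp only [mul_one] at hcs
  rw [integral_sub hx' (integrable_diag_of_bound (h.measurable_cov hγ) hC)] at hcs
  exact hcs

end Consistency

end ECF

/-! ### Consistency of the estimators -/

namespace ECF

theorem tendsto_coeff_trSqBR :
    Tendsto (fun d : ℝ => d * (d + 1) / ((d - 1) * (d + 2))) atTop (𝓝 1) := by
  have h : Tendsto (fun d : ℝ => (1 + d⁻¹) / ((1 - d⁻¹) * (1 + 2 * d⁻¹))) atTop (𝓝 1) := by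
    have hu := tendsto_inv_atTop_zero (𝕜 := ℝ)
    have := (hu.const_add 1).div ((hu.const_sub 1).mul ((hu.const_mul 2).const_add 1)) (by norm_num)
    simp only [add_zero, sub_zero, mul_zero, mul_one, div_one] at this
    exact this
  refine h.congr' ?_
  filter_upwards [eventually_gt_atTop 1] with d hd
  have h0 : d ≠ 0 := by linarith
  have h1 : d - 1 ≠ 0 := by linarith
  have h2 : d + 2 ≠ 0 := by linarith
  field_simp

theorem tendsto_coeff_trTwoBR :
    Tendsto (fun d : ℝ => d ^ 2 / ((d - 1) * (d + 2))) atTop (𝓝 1) := by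
  have h : Tendsto (fun d : ℝ => 1 / ((1 - d⁻¹) * (1 + 2 * d⁻¹))) atTop (𝓝 1) := by
    have hu := tendsto_inv_atTop_zero (𝕜 := ℝ)
    have := (tendsto_const_nhds (x := (1 : ℝ))).div
      ((hu.const_sub 1).mul ((hu.const_mul 2).const_add 1)) (by norm_num)
    simp only [add_zero, sub_zero, mul_zero, mul_one, div_one] at this
    exact this
  refine h.congr' ?_
  filter_upwards [eventually_gt_atTop 1] with d hd
  have h0 : d ≠ 0 := by linarith
  have h1 : d - 1 ≠ 0 := by linarith
  have h2 : d + 2 ≠ 0 := by linarith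
  field_simp

theorem tendsto_critValue {ι : Type*} {l : Filter ι} {A B : ι → ℝ} {A₀ B₀ : ℝ} {k : ℕ}
    (hk : 2 ≤ k) {α : ℝ} (hα : α ∈ Set.Ioo (0 : ℝ) 1) (hκ : 0 < B₀) (hA : Tendsto A l (𝓝 A₀)) (hB : Tendsto B l (𝓝 B₀)) :
    Tendsto (fun x => critValue k α (A x) (B x)) l (𝓝 (critValue k α A₀ B₀)) := by
  have hk' : (0 : ℝ) < (k : ℝ) - 1 := by
    have : (2 : ℝ) ≤ k := by exact_mod_cast hk
    linarith
  exact hA.mul ((chiSqUpper_continuousAt (mul_pos hk' hκ) hα).tendsto.comp (hB.const_mul _))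

/-! ### Consequences of the sample size assumption -/

section SampleSizes

variable {k : ℕ} {N : ℕ → Fin k → ℕ} {τ : Fin k → ℝ}

theorem tendsto_sampleSize (hn : Tendsto (fun m => total (N m)) atTop atTop)
    (hτ : ∀ i, τ i ∈ Set.Ioo (0 : ℝ) 1)
    (hA2 : ∀ i, Tendsto (fun m => (N m i : ℝ) / (total (N m) : ℝ)) atTop (𝓝 (τ i))) (i : Fin k) :
    Tendsto (fun m => N m i) atTop atTop := by
  have hn' : Tendsto (fun m => (total (N m) : ℝ)) atTop atTop :=
    tendsto_natCast_atTop_atTop.comp hn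
  have h := (hA2 i).pos_mul_atTop (hτ i).1 hn'
  rw [← tendsto_natCast_atTop_iff (R := ℝ)]
  refine h.congr' ?_
  filter_upwards [hn'.eventually_gt_atTop 0] with m hm
  exact div_mul_cancel₀ _ hm.ne'

/-- With no group the total would be `0`; with one group its share would be `1`, against `τ < 1`.
This makes the degrees of freedom `(k - 1) κ` positive. -/
theorem two_le_card (hn : Tendsto (fun m => total (N m)) atTop atTop)
    (hτ : ∀ i, τ i ∈ Set.Ioo (0 : ℝ) 1)
    (hA2 : ∀ i, Tendsto (fun m => (N m i : ℝ) / (total (N m) : ℝ)) atTop (𝓝 (τ i))) :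
    2 ≤ k := by
  by_contra hk
  have hk' : k = 0 ∨ k = 1 := by omega
  rcases hk' with rfl | rfl
  · obtain ⟨m, hm⟩ := (hn.eventually_gt_atTop 0).exists
    simp [total] at hm
  · have h1 : Tendsto (fun m => (N m 0 : ℝ) / (total (N m) : ℝ)) atTop (𝓝 1) := by
      refine tendsto_const_nhds.congr' ?_
      filter_upwards [hn.eventually_gt_atTop 0] with m hm
      have e : total (N m) = N m 0 := by simp [total]
      rw [e] at hm ⊢
      exact (div_self (by positivity)).symm
    exact (hτ 0).2.ne (tendsto_nhds_unique (hA2 0) h1)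

end SampleSizes

end ECF

theorem theorem1 {a b : ℝ} (hab : a < b) {k : ℕ}
    {Ω : Type*} [MeasurableSpace Ω] (P : Measure Ω) [IsProbabilityMeasure P]
    (η : Fin k → ECF.Time a b → ℝ) (γ : Fin k → ECF.Time a b → ECF.Time a b → ℝ)
    (v y : Fin k → ℕ → ECF.Time a b → Ω → ℝ)
    (hmodel : ECF.IsFunctionalSamples P η γ v y)
    -- A1: Gaussian samples
    (hA1 : ∀ i j, IsGaussianProcess (v i j) P)
    -- A2: sample sizes `N m i`, with total size tending to infinity
    (N : ℕ → Fin k → ℕ) (τ : Fin k → ℝ)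
    (hn : Tendsto (fun m => ECF.total (N m)) atTop atTop)
    (hτ : ∀ i, τ i ∈ Set.Ioo (0 : ℝ) 1)
    (hA2 : ∀ i, Tendsto (fun m => (N m i : ℝ) / (ECF.total (N m) : ℝ)) atTop (𝓝 (τ i)))
    -- A3: uniformly bounded covariance functions
    (hA3 : ∃ C : ℝ, ∀ i s t, |γ i s t| ≤ C)
    -- null hypothesis, with common covariance function `γ₀`, not degenerate
    (γ₀ : ECF.Time a b → ECF.Time a b → ℝ) (hH0 : ∀ i s t, γ i s t = γ₀ s t)
    (hpos : 0 < ECF.tr γ₀)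
    (α : ℝ) (hα : α ∈ Set.Ioo (0 : ℝ) 1) :
    ∃ ϖ : ECF.Time a b × ECF.Time a b → ECF.Time a b × ECF.Time a b → ℝ,
      -- `ϖ` is the covariance function of `√(n-k) (γ̂ - γ₀)`, whatever the sample sizes
      (∀ m, (∀ i, 2 ≤ N m i) → ∀ p q, ECF.pooledCovKernel P (N m) γ₀ y p q = ϖ p q) ∧
      -- `β` and `κ` are well defined
      0 < ECF.trK ϖ ∧ 0 < ECF.trTwoK ϖ ∧
      -- naive method
      TendstoInMeasure P (fun m ω => ECF.betaNaive (N m) (ECF.curves y ω)) atTop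
        (fun _ => ECF.beta ϖ) ∧
      TendstoInMeasure P (fun m ω => ECF.kappaNaive (N m) (ECF.curves y ω)) atTop
        (fun _ => ECF.kappa ϖ) ∧
      TendstoInMeasure P
        (fun m ω => ECF.critValue k α (ECF.betaNaive (N m) (ECF.curves y ω))
          (ECF.kappaNaive (N m) (ECF.curves y ω))) atTop
        (fun _ => ECF.critValue k α (ECF.beta ϖ) (ECF.kappa ϖ)) ∧
      -- bias-reduced method
      TendstoInMeasure P (fun m ω => ECF.betaBR (N m) (ECF.curves y ω)) atTop
        (fun _ => ECF.beta ϖ) ∧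
      TendstoInMeasure P (fun m ω => ECF.kappaBR (N m) (ECF.curves y ω)) atTop
        (fun _ => ECF.kappa ϖ) ∧
      TendstoInMeasure P
        (fun m ω => ECF.critValue k α (ECF.betaBR (N m) (ECF.curves y ω))
          (ECF.kappaBR (N m) (ECF.curves y ω))) atTop
        (fun _ => ECF.critValue k α (ECF.beta ϖ) (ECF.kappa ϖ)) := by
  have hk := ECF.two_le_card hn hτ hA2
  have : NeZero k := ⟨by omega⟩
  obtain ⟨C, hC'⟩ := hA3
  have hC : ∀ s t, |γ₀ s t| ≤ C := fun s t => by rw [← hH0 0]; exact hC' 0 s t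
  have hN : ∀ᶠ m in atTop, ∀ i, 2 ≤ N m i := by
    rw [eventually_all]
    exact fun i => (ECF.tendsto_sampleSize hn hτ hA2 i).eventually_ge_atTop 2
  have hd : Tendsto (fun m => ECF.dof (N m)) atTop atTop :=
    tendsto_atTop_add_const_right _ _ (tendsto_natCast_atTop_atTop.comp hn)
  have hmeas := hmodel.measurable_cov hH0
  have hsq := ECF.sqIntegrable_of_bound hmeas hC
  have hdiag := ECF.integrable_diag_of_bound hmeas hC
  have htwo := hmodel.trTwo_pos hH0 hC hpos
  have hfour := hsq.trFour_nonneg (hmodel.symm hH0)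
  have hK := hsq.trK_plugIn hdiag
  have hKK := hsq.trTwoK_plugIn (hmodel.symm hH0)
  have hKpos : 0 < ECF.trK (ECF.plugIn γ₀) := by rw [hK]; positivity
  have hKKpos : 0 < ECF.trTwoK (ECF.plugIn γ₀) := by rw [hKK]; positivity
  have hκ : 0 < ECF.kappa (ECF.plugIn γ₀) := div_pos (pow_pos hKpos 2) hKKpos
  have hSq := hmodel.eventually_sqIntegrable_pooledCov hA1 hH0 hC hN
  have herr := hmodel.tendsto_trTwo_error hA1 hH0 hC hN hd
  have l1 := hmodel.tendsto_tr_pooledCov hA1 hH0 hC hN hd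
  have l2 := ECF.tendsto_trTwo hsq hSq herr
  have l4 := ECF.tendsto_trFour hsq hSq herr
  have ld : Tendsto (fun x : ℕ × Ω => ECF.dof (N x.1)) (inProbability P atTop) atTop :=
    hd.comp tendsto_fst_inProbability
  -- naive estimators of `tr(ϖ)` and `tr(ϖ^{⊗2})`
  have nA : Tendsto (fun x : ℕ × Ω =>
      ECF.trK (ECF.plugIn (ECF.pooledCov (N x.1) (ECF.curves y x.2))))
      (inProbability P atTop) (𝓝 (ECF.trK (ECF.plugIn γ₀))) := by
    rw [hK]
    refine ((l1.pow 2).add l2).congr' ?_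
    filter_upwards [hSq, hmodel.eventually_integrable_diag hA1 hH0 hC hN] with x hx hx'
    exact (hx.trK_plugIn hx').symm
  have nB : Tendsto (fun x : ℕ × Ω =>
      ECF.trTwoK (ECF.plugIn (ECF.pooledCov (N x.1) (ECF.curves y x.2))))
      (inProbability P atTop) (𝓝 (ECF.trTwoK (ECF.plugIn γ₀))) := by
    rw [hKK]
    refine (((l2.pow 2).const_mul 2).add (l4.const_mul 2)).congr' ?_
    filter_upwards [hSq] with x hx
    exact (hx.trTwoK_plugIn (ECF.pooledCov_symm _ _)).symm
  -- bias-reduced estimators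
  have bD : Tendsto (fun x : ℕ × Ω => ECF.trSqBR (N x.1) (ECF.curves y x.2))
      (inProbability P atTop) (𝓝 (ECF.tr γ₀ ^ 2)) := by
    -- The subtracted term is a convergent trace divided by `n - k + 1`, hence vanishes in the
    -- limit.
    have := (ECF.tendsto_coeff_trSqBR.comp ld).mul ((l1.pow 2).sub
      ((l2.const_mul 2).div_atTop (tendsto_atTop_add_const_right _ 1 ld)))
    rw [sub_zero, one_mul] at this
    exact this
  have bE : Tendsto (fun x : ℕ × Ω => ECF.trTwoBR (N x.1) (ECF.curves y x.2))
      (inProbability P atTop) (𝓝 (ECF.trTwo γ₀)) := by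
    have := (ECF.tendsto_coeff_trTwoBR.comp ld).mul (l2.sub ((l1.pow 2).div_atTop ld))
    rw [sub_zero, one_mul] at this
    exact this
  have bA : Tendsto (fun x : ℕ × Ω => ECF.trKBR (N x.1) (ECF.curves y x.2))
      (inProbability P atTop) (𝓝 (ECF.trK (ECF.plugIn γ₀))) := by
    rw [hK]
    exact bD.add bE
  have bB : Tendsto (fun x : ℕ × Ω => ECF.trTwoKBR (N x.1) (ECF.curves y x.2))
      (inProbability P atTop) (𝓝 (ECF.trTwoK (ECF.plugIn γ₀))) := by
    rw [hKK]
    exact ((bE.pow 2).const_mul 2).add (l4.const_mul 2)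
  simp only [tendstoInMeasure_const_iff_tendsto_inProbability]
  have nβ := nB.div nA hKpos.ne'
  have nκ := (nA.pow 2).div nB hKKpos.ne'
  have bβ := bB.div bA hKpos.ne'
  have bκ := (bA.pow 2).div bB hKKpos.ne'
  exact ⟨ECF.plugIn γ₀, fun m hm p q => hmodel.pooledCovKernel_eq hA1 hH0 hm p q, hKpos, hKKpos,
    nβ, nκ, ECF.tendsto_critValue hk hα hκ nβ nκ, bβ, bκ, ECF.tendsto_critValue hk hα hκ bβ bκ⟩
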